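/- **Electric power system (EPS).** Let $\mathcal E$ be a finite set of buses with a reference bus $r$, and let each heat pump (HP) $k\in\mathcal H$ sit at a bus $i_k\in\mathcal E$, different HPs at different buses. With $M_i,T_{g,i},K^P_i,K^I,V_i>0$, $B_{ij}=B_{ji}$ and constant electrical disturbances $P^L_i$, the EPS with droop and AGC control is, for $i\in\mathcal E$, $$\dot\theta_i=\omega_i-\omega_r\ (\theta_r=0),\qquad M_i\dot\omega_i=-D_i\omega_i-P_i+P^G_i-p^H_i,\qquad P_i=\sum_j|B_{ij}|V_iV_j\sin(\theta_i-\theta_j)-P^L_i,$$ $$T_{g,i}\dot P^G_i=-P^G_i+u_i,\qquad u_i=-K^P_i\omega_i+\delta_{ir}K^Ig,\qquad \dot g=-\omega_r,$$ where $p^H_i$ is the power drawn by the HP at bus $i$ ($0$ if there is none). The graph of the lines $\{i,j\}$, $B_{ij}\ne0$, is connected. A state is called *secure* if $|\theta_i-\theta_j|<\pi/2$ whenever $B_{ij}\neq 0$. Put $\omega^{HP}=(\omega_{i_k})_k$ and $p^H=(p^H_{i_k})_k$. **District heating system (DHS).** A heating network has edges (conventional sources $1,\dots,n^G$ with $n^G\ge1$,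 HPs, loads) and nodes; edge $j$ is fed by node $s(j)$ and discharges into node $t(j)$. With $\rho,C_p>0$, volumes $V_j^E,V_k^N>0$, mass flows $q_j$ and constant loads $h^L$, the temperatures $T=(T^E,T^N)$ satisfy $$\rho C_pV^E_j\dot T^E_j=\rho C_pq_j(T^N_{s(j)}-T^E_j)+h^G_j+h^P_j-h^L_j,\qquad \rho C_pV^N_k\dot T^N_k=\sum_{j:\,t(j)=k}\rho C_pq_j(T^E_j-T^N_k),$$ where $h^G$, $h^P$, $h^L$ act only on source, HP and load edges, respectively. The error is $e=CT+Dh^G=(e^G,\mathrm{Sig}^H)$ with $e^G_i=f^G_ih^G_i-f^G_{i+1}h^G_{i+1}$ for $1\le i<n^G$, $\mathrm{Sig}^H=\sum_lF^D_lT_l$, and $f^G_i,F^D_l>0$. The HPs satisfy $h^P_k=\mathrm{CoP}_k\,p^H_k$ and $p^H_k=\gamma^E_k\omega^{HP}_k+\gamma^H_k\mathrm{Sig}^H$. With $\dot\xi=e$, $x=(T,\xi)$ and the regulator $h^G=-Kx=-K_TT-K_I\xi$, this becomes the closed-loop augmented DHS $$\dot x=A_{cl}x+B_{cl}^{(\omega)}\omega^{HP}+B_{cl}^{(h)}w^h,\qquad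 p^H=\gamma^E\omega^{HP}+C_y(K)x,$$ where $w^h$ is the constant heat disturbance caused by $h^L$. The CHP system is the interconnection of the EPS and this DHS through $\omega^{HP}$ and $p^H$. **Theorem 1.** Assume: 1. (Assumption 1) for the given constant $P^L$, and with $p^H=0$, the EPS with AGC has a secure equilibrium with $\omega^*=\omega^{com}\mathbf 1$; 2. (Assumption 2) there is $D_{\min}>0$ with $D_i\ge D_{\min}$ for all $i$, and for each $i$ there is $\rho_i>0$ such that $G_i(s)=D_i+\frac{K^P_i}{T_{g,i}s+1}+\delta_{ir}\frac{K^I}{s(T_{g,i}s+1)}$ satisfies $\Re G_i(\mathrm j w)\ge\rho_i$ for all $w\in\mathbb R$ ($w\ne0$ if $i=r$, where $G_r$ has a pole at $0$); 3. the closed-loop augmented DHS is strictly passive from $\omega^{HP}$ to $p^H$: there are a $C^1$ storage function $V_h\ge0$ of $x$ and $\rho_h>0$ with $\dot V_h\le (p^H)^\top\omega^{HP}-\rho_h\|p^H\|^2$ along all trajectories, for all inputs; 4. $A_{cl}$ is Hurwitz. Then the CHP system has exactly one equilibrium whose EPS part is secure. At it $\omega^*=0$ and $e^*=0$, and it is asymptotically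 stable: it is Lyapunov stable, and from every initial state sufficiently close to it there are solutions on $[0,\infty)$, all of which converge to it. -/

import Mathlib

open scoped Topology

noncomputable section

/-! ## Dynamical notions -/

/-- `x` is a solution of `ẋ = f x` on `[0, ∞)` (one-sided derivative at `0`). -/
def IsSolution {E : Type*} [NormedAddCommGroup E] [NormedSpace ℝ E]
    (f : E → E) (x : ℝ → E) : Prop :=
  ∀ t : ℝ, 0 ≤ t → HasDerivWithinAt x (f (x t)) (Set.Ici 0) t

/-- `xs` is an asymptotically stable equilibrium of `ẋ = f x`: it is an equilibrium, it is stable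
in the sense of Lyapunov, and from every initial state near `xs` there is a solution on `[0, ∞)`,
all such solutions converging to `xs`. -/
def AsymptoticallyStable {E : Type*} [NormedAddCommGroup E] [NormedSpace ℝ E]
    (f : E → E) (xs : E) : Prop :=
  f xs = 0 ∧
  (∀ ε : ℝ, 0 < ε → ∃ δ : ℝ, 0 < δ ∧ ∀ x : ℝ → E, IsSolution f x →
    ‖x 0 - xs‖ < δ → ∀ t : ℝ, 0 ≤ t → ‖x t - xs‖ < ε) ∧
  (∃ δ : ℝ, 0 < δ ∧ ∀ x₀ : E, ‖x₀ - xs‖ < δ →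
    (∃ x : ℝ → E, IsSolution f x ∧ x 0 = x₀) ∧
    ∀ x : ℝ → E, IsSolution f x → x 0 = x₀ → Filter.Tendsto x Filter.atTop (𝓝 xs))

/-- Strict passivity of `ẋ = f x u`, `y = h x u` from `u` to `y`: there are a nonnegative
continuously differentiable storage function `V` and `ρ > 0` with
`V̇ ≤ yᵀ u - ρ ‖y‖²` along all trajectories. -/
def StrictlyPassive {X ι : Type*} [NormedAddCommGroup X] [NormedSpace ℝ X] [Fintype ι]
    (f : X → (ι → ℝ) → X) (h : X → (ι → ℝ) → (ι → ℝ)) : Prop :=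
  ∃ (V : X → ℝ) (ρ : ℝ), 0 < ρ ∧ ContDiff ℝ 1 V ∧ (∀ x, 0 ≤ V x) ∧
    ∀ (x : X) (u : ι → ℝ),
      fderiv ℝ V x (f x u) ≤ h x u ⬝ᵥ u - ρ * (h x u ⬝ᵥ h x u)

/-- A real square matrix is Hurwitz if all its complex eigenvalues have negative real part. -/
def Hurwitz {ι : Type*} [Fintype ι] [DecidableEq ι] (A : Matrix ι ι ℝ) : Prop :=
  ∀ μ ∈ spectrum ℂ (A.map Complex.ofReal), μ.re < 0

/-! ## Electric power system (EPS) -/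

/-- Parameters of the electric power system with reference (AGC) bus `r`. A bus hosts a heat pump
iff it is in the range of `hpBus`, and then it hosts exactly one. -/
structure EPS (Bus HP : Type*) (r : Bus) where
  /-- inertia -/
  M : Bus → ℝ
  /-- damping coefficients -/
  D : Bus → ℝ
  /-- turbine-governor time constants -/
  Tg : Bus → ℝ
  /-- droop gains -/
  KP : Bus → ℝ
  /-- AGC gain -/
  KI : ℝ
  /-- line susceptances -/
  B : Bus → Bus → ℝ
  /-- voltage magnitudes -/
  V : Bus → ℝ
  /-- location of the heat pumps -/
  hpBus : HP ↪ Bus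
  M_pos : ∀ i, 0 < M i
  Tg_pos : ∀ i, 0 < Tg i
  KP_pos : ∀ i, 0 < KP i
  KI_pos : 0 < KI
  V_pos : ∀ i, 0 < V i
  B_symm : ∀ i j, B i j = B j i

/-- EPS state: phase angles `xθ` relative to the reference bus, frequency deviations `ω`,
generations `PG` and the AGC state `g`. -/
abbrev EPSState (Bus : Type*) (r : Bus) : Type _ :=
  ({i : Bus // i ≠ r} → ℝ) × (Bus → ℝ) × (Bus → ℝ) × ℝ

namespace EPSState

variable {Bus : Type*} {r : Bus}

def xθ (s : EPSState Bus r) : {i : Bus // i ≠ r} → ℝ := s.1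
def ω (s : EPSState Bus r) : Bus → ℝ := s.2.1
def PG (s : EPSState Bus r) : Bus → ℝ := s.2.2.1
def g (s : EPSState Bus r) : ℝ := s.2.2.2

/-- Bus angles, with the angle of the reference bus as origin. -/
def θ [DecidableEq Bus] (s : EPSState Bus r) (i : Bus) : ℝ :=
  if h : i ≠ r then s.xθ ⟨i, h⟩ else 0

end EPSState

namespace EPS

variable {Bus HP : Type*} {r : Bus}

/-- The graph of the transmission lines. -/
def graph (eps : EPS Bus HP r) : SimpleGraph Bus :=
  SimpleGraph.fromRel fun i j => eps.B i j ≠ 0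

/-- Net active power flowing out of bus `i`. -/
def netPower [Fintype Bus] [DecidableEq Bus] (eps : EPS Bus HP r) (PL : Bus → ℝ)
    (s : EPSState Bus r) (i : Bus) : ℝ :=
  (∑ j, |eps.B i j| * eps.V i * eps.V j * Real.sin (s.θ i - s.θ j)) - PL i

/-- Power drawn by the heat pump at bus `i`; it is `0` if there is none. -/
def hpPower [Fintype HP] [DecidableEq Bus] (eps : EPS Bus HP r) (pH : HP → ℝ) (i : Bus) : ℝ :=
  ∑ k, if eps.hpBus k = i then pH k else 0

/-- Generation control: droop at every bus, integral (AGC) action at the reference bus. -/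
def control [DecidableEq Bus] (eps : EPS Bus HP r) (s : EPSState Bus r) (i : Bus) : ℝ :=
  -eps.KP i * s.ω i + if i = r then eps.KI * s.g else 0

/-- Right-hand side of the EPS dynamics under the AGC controller, with electrical disturbance `PL`
and heat-pump consumption `pH`. -/
def field [Fintype Bus] [DecidableEq Bus] [Fintype HP] (eps : EPS Bus HP r) (PL : Bus → ℝ)
    (s : EPSState Bus r) (pH : HP → ℝ) : EPSState Bus r :=
  (fun i => s.ω i - s.ω r,
   fun i => (-eps.D i * s.ω i - eps.netPower PL s i + s.PG i - eps.hpPower pH i) / eps.M i,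
   fun i => (-s.PG i + eps.control s i) / eps.Tg i,
   -s.ω r)

/-- Frequencies of the buses that host heat pumps. -/
def ωHP (eps : EPS Bus HP r) (s : EPSState Bus r) : HP → ℝ := fun k => s.ω (eps.hpBus k)

/-- Angle differences across the lines are smaller than `π / 2`. -/
def Secure [DecidableEq Bus] (eps : EPS Bus HP r) (s : EPSState Bus r) : Prop :=
  ∀ i j, eps.B i j ≠ 0 → |s.θ i - s.θ j| < Real.pi / 2

/-- For the constant inputs `PL` and `pH` the EPS with AGC has a synchronous equilibrium, with
angle differences across the lines smaller than `π / 2`. -/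
def AdmitsEquilibrium [Fintype Bus] [DecidableEq Bus] [Fintype HP] (eps : EPS Bus HP r)
    (PL : Bus → ℝ) (pH : HP → ℝ) : Prop :=
  ∃ s : EPSState Bus r, eps.field PL s pH = 0 ∧ (∃ ωcom : ℝ, s.ω = fun _ => ωcom) ∧ eps.Secure s

/-- The transfer function of damping and generation at bus `i`. -/
def G [DecidableEq Bus] (eps : EPS Bus HP r) (i : Bus) (s : ℂ) : ℂ :=
  (eps.D i : ℂ) + (eps.KP i : ℂ) / ((eps.Tg i : ℂ) * s + 1) +
    if i = r then (eps.KI : ℂ) / (s * ((eps.Tg i : ℂ) * s + 1)) else 0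

/-- Uniformly positive damping, and strict positive realness of every `G i`. At the reference bus
`G` has a pole at `0`, so the frequency `0` is excluded there. -/
def DampedSPR [DecidableEq Bus] (eps : EPS Bus HP r) : Prop :=
  (∃ Dmin : ℝ, 0 < Dmin ∧ ∀ i, Dmin ≤ eps.D i) ∧
  ∀ i, ∃ ρ : ℝ, 0 < ρ ∧
    ∀ w : ℝ, (i = r → w ≠ 0) → ρ ≤ (eps.G i (Complex.I * (w : ℂ))).re

end EPS

/-! ## District heating system (DHS) -/

/-- Edges of the heating network: `m + 1` conventional sources, the heat pumps, the loads. -/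
abbrev HeatEdge (m : ℕ) (HP L : Type*) : Type _ := Fin (m + 1) ⊕ HP ⊕ L

/-- Index set of the temperatures: edges and nodes. -/
abbrev TempIdx (m : ℕ) (HP L N : Type*) : Type _ := HeatEdge m HP L ⊕ N

/-- Index set of the error `e = (e^G, Sig^H)`. -/
abbrev ErrIdx (m : ℕ) : Type := Fin m ⊕ Unit

/-- Parameters of the district heating system. Edge `j` is fed by node `src j` and discharges into
node `tgt j`. -/
structure DHS (m : ℕ) (HP L N : Type*) where
  /-- density of water -/
  rho : ℝ
  /-- specific heat capacity of water -/
  Cp : ℝ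
  /-- volumes of the edges -/
  VE : HeatEdge m HP L → ℝ
  /-- volumes of the nodes -/
  VN : N → ℝ
  /-- mass flows along the edges -/
  q : HeatEdge m HP L → ℝ
  src : HeatEdge m HP L → N
  tgt : HeatEdge m HP L → N
  /-- cost coefficients of the conventional sources -/
  fG : Fin (m + 1) → ℝ
  /-- temperature deviation penalties -/
  fD : TempIdx m HP L N → ℝ
  /-- coefficients of performance -/
  CoP : HP → ℝ
  /-- electrical operation coefficients of the heat pumps -/
  γE : HP → ℝ
  /-- thermal operation coefficients of the heat pumps -/
  γH : HP → ℝ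
  rho_pos : 0 < rho
  Cp_pos : 0 < Cp
  VE_pos : ∀ j, 0 < VE j
  VN_pos : ∀ k, 0 < VN k
  fG_pos : ∀ i, 0 < fG i
  fD_pos : ∀ i, 0 < fD i

/-- State `x = (T, ξ)` of the augmented DHS. -/
abbrev DHSState (m : ℕ) (HP L N : Type*) : Type _ := (TempIdx m HP L N ⊕ ErrIdx m) → ℝ

namespace DHS

open Matrix

variable {m : ℕ} {HP L N : Type*}

/-- The Kirchhoff matrix `A_h`: `-A_h T` lists
`ρ C_p q_j (T_{src j} - T_j)` for the edges `j` and
`∑_{tgt j = k} ρ C_p q_j (T_j - T_k)` for the nodes `k`. -/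
def Ah [Fintype HP] [Fintype L] [DecidableEq HP] [DecidableEq L] [DecidableEq N]
    (dhs : DHS m HP L N) : Matrix (TempIdx m HP L N) (TempIdx m HP L N) ℝ :=
  fromBlocks
    (diagonal fun j => dhs.rho * dhs.Cp * dhs.q j)
    (of fun j k => if dhs.src j = k then -(dhs.rho * dhs.Cp * dhs.q j) else 0)
    (of fun k j => if dhs.tgt j = k then -(dhs.rho * dhs.Cp * dhs.q j) else 0)
    (diagonal fun k => ∑ j, if dhs.tgt j = k then dhs.rho * dhs.Cp * dhs.q j else 0)

/-- Heat capacities of edges and nodes. -/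
def cap (dhs : DHS m HP L N) : TempIdx m HP L N → ℝ :=
  Sum.elim (fun j => dhs.rho * dhs.Cp * dhs.VE j) (fun k => dhs.rho * dhs.Cp * dhs.VN k)

/-- The inverse of the diagonal matrix of heat capacities. -/
def Vinv [DecidableEq HP] [DecidableEq L] [DecidableEq N] (dhs : DHS m HP L N) :
    Matrix (TempIdx m HP L N) (TempIdx m HP L N) ℝ :=
  diagonal fun i => (dhs.cap i)⁻¹

variable [Fintype HP] [Fintype L] [Fintype N] [DecidableEq HP] [DecidableEq L] [DecidableEq N]

def A (dhs : DHS m HP L N) : Matrix (TempIdx m HP L N) (TempIdx m HP L N) ℝ :=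
  dhs.Vinv * dhs.Ah

def B₁ (dhs : DHS m HP L N) : Matrix (TempIdx m HP L N) (Fin (m + 1)) ℝ :=
  dhs.Vinv * of fun (i : TempIdx m HP L N) j => if i = Sum.inl (Sum.inl j) then (1 : ℝ) else 0

def B₂ (dhs : DHS m HP L N) : Matrix (TempIdx m HP L N) HP ℝ :=
  dhs.Vinv * of fun (i : TempIdx m HP L N) k => if i = Sum.inl (Sum.inr (Sum.inl k)) then (1 : ℝ) else 0

/-- The heat disturbance caused by the loads `hL`. -/
def wh (dhs : DHS m HP L N) (hL : L → ℝ) : TempIdx m HP L N → ℝ :=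
  dhs.Vinv *ᵥ Sum.elim (Sum.elim 0 (Sum.elim 0 (-hL))) 0

/-- The bidiagonal matrix with rows `f_i h_i - f_{i+1} h_{i+1}`, which compares the marginal costs
of consecutive conventional sources. -/
def FM (dhs : DHS m HP L N) : Matrix (Fin m) (Fin (m + 1)) ℝ :=
  of fun i j => if j = i.castSucc then dhs.fG j else if j = i.succ then -dhs.fG j else 0

/-- `C = [0; 1ᵀ F^D]`. -/
def C (dhs : DHS m HP L N) : Matrix (ErrIdx m) (TempIdx m HP L N) ℝ :=
  fromRows 0 (of fun _ j => dhs.fD j)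

/-- `D = [F^M; 0]`. -/
def D (dhs : DHS m HP L N) : Matrix (ErrIdx m) (Fin (m + 1)) ℝ :=
  fromRows dhs.FM 0

/-- `1 s_T`, where `s_T = [0ᵀ 1]` selects `Sig^H` from the error and `1` is the all-ones column. -/
def onesT (m : ℕ) (HP : Type*) : Matrix HP (ErrIdx m) ℝ :=
  of fun _ => Sum.elim 0 1

/-- `B_s = B₂ CoP γ^H 1 s_T`. -/
def Bs (dhs : DHS m HP L N) : Matrix (TempIdx m HP L N) (ErrIdx m) ℝ :=
  dhs.B₂ * diagonal dhs.CoP * diagonal dhs.γH * onesT m HP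

/-- `B_ω = B₂ CoP γ^E`. -/
def Bω (dhs : DHS m HP L N) : Matrix (TempIdx m HP L N) HP ℝ :=
  dhs.B₂ * diagonal dhs.CoP * diagonal dhs.γE

/-- `A_e = -A + B_s C`. -/
def Ae (dhs : DHS m HP L N) : Matrix (TempIdx m HP L N) (TempIdx m HP L N) ℝ :=
  -dhs.A + dhs.Bs * dhs.C

/-- `B_e = B₁ + B_s D`. -/
def Be (dhs : DHS m HP L N) : Matrix (TempIdx m HP L N) (Fin (m + 1)) ℝ :=
  dhs.B₁ + dhs.Bs * dhs.D

/-- The closed-loop matrix under the regulator `h^G = -K_T T - K_I ξ`. -/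
def Acl (dhs : DHS m HP L N) (KT : Matrix (Fin (m + 1)) (TempIdx m HP L N) ℝ)
    (KI : Matrix (Fin (m + 1)) (ErrIdx m) ℝ) :
    Matrix (TempIdx m HP L N ⊕ ErrIdx m) (TempIdx m HP L N ⊕ ErrIdx m) ℝ :=
  fromBlocks (dhs.Ae - dhs.Be * KT) (-(dhs.Be * KI))
    (dhs.C - dhs.D * KT) (-(dhs.D * KI))

/-- `B_cl^(ω) = [B_ω; 0]`. -/
def Bclω (dhs : DHS m HP L N) : Matrix (TempIdx m HP L N ⊕ ErrIdx m) HP ℝ :=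
  fromRows dhs.Bω 0

/-- `B_cl^(h) = [I; 0]`. -/
def Bclh (_dhs : DHS m HP L N) :
    Matrix (TempIdx m HP L N ⊕ ErrIdx m) (TempIdx m HP L N) ℝ :=
  fromRows 1 0

/-- `S_C = γ^H [1 s_T C, 0]`. -/
def SC (dhs : DHS m HP L N) : Matrix HP (TempIdx m HP L N ⊕ ErrIdx m) ℝ :=
  diagonal dhs.γH * fromCols (onesT m HP * dhs.C) 0

/-- `S_D = γ^H 1 s_T D`. -/
def SD (dhs : DHS m HP L N) : Matrix HP (Fin (m + 1)) ℝ :=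
  diagonal dhs.γH * (onesT m HP * dhs.D)

/-- The regulator `h^G = -K x`, `K = [K_T K_I]`. -/
def hG (_dhs : DHS m HP L N) (KT : Matrix (Fin (m + 1)) (TempIdx m HP L N) ℝ)
    (KI : Matrix (Fin (m + 1)) (ErrIdx m) ℝ) (x : DHSState m HP L N) : Fin (m + 1) → ℝ :=
  -(fromCols KT KI *ᵥ x)

/-- The error `e = C T + D h^G` of the regulated DHS. -/
def err (dhs : DHS m HP L N) (KT : Matrix (Fin (m + 1)) (TempIdx m HP L N) ℝ)
    (KI : Matrix (Fin (m + 1)) (ErrIdx m) ℝ) (x : DHSState m HP L N) : ErrIdx m → ℝ :=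
  dhs.C *ᵥ (fun i => x (Sum.inl i)) + dhs.D *ᵥ dhs.hG KT KI x

/-- Closed-loop augmented DHS: `ẋ = A_cl x + B_cl^(ω) u₂ + B_cl^(h) w^h`, with input
`u₂ = ω^HP`. -/
def field (dhs : DHS m HP L N) (KT : Matrix (Fin (m + 1)) (TempIdx m HP L N) ℝ)
    (KI : Matrix (Fin (m + 1)) (ErrIdx m) ℝ) (hL : L → ℝ)
    (x : DHSState m HP L N) (u : HP → ℝ) : DHSState m HP L N :=
  dhs.Acl KT KI *ᵥ x + dhs.Bclω *ᵥ u + dhs.Bclh *ᵥ dhs.wh hL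

/-- Output of the closed-loop augmented DHS: `p^H = γ^E u₂ + (S_C - S_D K) x`. -/
def pH (dhs : DHS m HP L N) (KT : Matrix (Fin (m + 1)) (TempIdx m HP L N) ℝ)
    (KI : Matrix (Fin (m + 1)) (ErrIdx m) ℝ)
    (x : DHSState m HP L N) (u : HP → ℝ) : HP → ℝ :=
  diagonal dhs.γE *ᵥ u + (dhs.SC - dhs.SD * fromCols KT KI) *ᵥ x

end DHS

/-! ## Interconnection -/

/-- The combined heat and power (CHP) system: EPS and regulated DHS coupled through
`ω^HP` and `p^H`. -/
def chpField {Bus HP L N : Type*} {r : Bus} {m : ℕ}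
    [Fintype Bus] [Fintype HP] [Fintype L] [Fintype N]
    [DecidableEq Bus] [DecidableEq HP] [DecidableEq L] [DecidableEq N]
    (eps : EPS Bus HP r) (dhs : DHS m HP L N)
    (KT : Matrix (Fin (m + 1)) (TempIdx m HP L N) ℝ)
    (KI : Matrix (Fin (m + 1)) (ErrIdx m) ℝ) (PL : Bus → ℝ) (hL : L → ℝ)
    (s : EPSState Bus r × DHSState m HP L N) : EPSState Bus r × DHSState m HP L N :=
  (eps.field PL s.1 (dhs.pH KT KI s.2 (eps.ωHP s.1)),
   dhs.field KT KI hL s.2 (eps.ωHP s.1))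

end

/-! At any equilibrium the AGC state forces the reference frequency, and then all frequencies, to
vanish. The heating side is then fed with zero input, so its rest point is unique because `Acl` is
invertible, and strict passivity there reads `0 ≤ -ρ‖pH‖²`: the heat pumps draw no power. The two
systems thus decouple at rest, and the electrical part is the equilibrium granted for `pH = 0`. It
is the only secure one: summing the power balances fixes `g`, while strict monotonicity of the sine
and connectedness fix the angles (`θ_g_eq_of_mismatch_eq_zero`). The error vanishes because it is
the derivative of the integrator states.

For stability, the governor at each bus is split into the lossless integrator `KI / s` and a
first-order mode of gain `fastGain`. Letting the frequency tend to `0` in the positive realness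
condition gives `D + fastGain > 0`. With `D > 0` this allows a weight for the storage of the fast
mode that makes its supply rate negative definite (`exists_weight_of_feedthrough`). The incremental
energy then decays up to the exchanged term `-pH ⬝ᵥ ωHP`, which cancels against the supply of the
heating storage `V`. A small multiple of a quadratic Lyapunov function of the heating system makes
the sum `W` locally positive definite.

The bound on the decay of `W` misses angles and AGC state. Rather than an invariance argument, the
correlation `crossEnergy` of power mismatch and momentum is added to a large multiple of `W`; it
supplies minus the squared mismatch. The result need not have a sign, but it decreases at a positive
definite rate, which suffices once `W` confines the solutions (`asymptoticallyStable_of_lyapunov`).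
-/

/-! ### Global solutions and Lyapunov's direct method -/

section Dynamics

variable {E : Type*} [NormedAddCommGroup E] [NormedSpace ℝ E]

/-- Local solutions of a globally Lipschitz equation live for a time that does not depend on the
initial state. -/
theorem LipschitzWith.exists_local_solution [CompleteSpace E] {f : E → E} {K : NNReal}
    (hf : LipschitzWith K f) (x₀ : E) :
    ∃ γ : ℝ → E, γ 0 = x₀ ∧ ∀ t ∈ Set.Ioo (-(2 * (K + 1 : ℝ))⁻¹) (2 * (K + 1 : ℝ))⁻¹,
      HasDerivAt γ (f (γ t)) t := by
  set τ : ℝ := (2 * (K + 1 : ℝ))⁻¹ with hτ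
  have hK : (0 : ℝ) ≤ K := K.2
  have hτpos : 0 < τ := by positivity
  let t₀ : Set.Icc (-τ) τ := ⟨0, by constructor <;> linarith⟩
  -- On the ball of radius `‖f x₀‖` the field is at most `(K + 1)‖f x₀‖`. Radius and speed scale
  -- alike, so the time is independent of `x₀`; with the doubled speed bound the time condition is
  -- an equality.
  have hPL : IsPicardLindelof (fun _ => f) t₀ x₀ ‖f x₀‖₊ 0 ((K + 1) * (2 * ‖f x₀‖₊)) K := by
    apply IsPicardLindelof.of_time_independent
    · intro x hx
      have h1 : ‖f x - f x₀‖ ≤ K * ‖x - x₀‖ := by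
        simpa [dist_eq_norm] using hf.dist_le_mul x x₀
      have h2 : ‖x - x₀‖ ≤ ‖f x₀‖ := by
        simpa [dist_eq_norm] using hx
      have h3 : ‖f x‖ ≤ ‖f x - f x₀‖ + ‖f x₀‖ := by
        simpa using norm_add_le (f x - f x₀) (f x₀)
      have h4 : (K : ℝ) * ‖x - x₀‖ ≤ K * ‖f x₀‖ := by gcongr
      push_cast
      nlinarith [norm_nonneg (f x₀), mul_nonneg hK (norm_nonneg (f x₀))]
    · exact hf.lipschitzOnWith
    · have : max (τ - 0) (0 - -τ) = τ := by simp
      simp only [t₀, this]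
      push_cast
      simp only [sub_zero]
      apply le_of_eq
      rw [hτ]
      field_simp
  obtain ⟨γ, h0, hγ⟩ := hPL.exists_eq_forall_mem_Icc_hasDerivWithinAt₀
  exact ⟨γ, h0, fun t ht => (hγ t (Set.Ioo_subset_Icc_self ht)).hasDerivAt
    (Icc_mem_nhds ht.1 ht.2)⟩

open scoped Manifold in
/-- A globally Lipschitz `C¹` vector field is complete. -/
theorem LipschitzWith.exists_isSolution [CompleteSpace E] {f : E → E} {K : NNReal}
    (hf : LipschitzWith K f) (hf' : ContDiff ℝ 1 f) (x₀ : E) :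
    ∃ x : ℝ → E, IsSolution f x ∧ x 0 = x₀ := by
  have hε : 0 < (2 * (K + 1 : ℝ))⁻¹ := by positivity
  -- A uniform lifespan extends local solutions to all times. The extension result is stated for
  -- manifolds, so `E` is regarded as one.
  obtain ⟨γ, h0, hγ⟩ := exists_isMIntegralCurve_of_isMIntegralCurveOn (I := 𝓘(ℝ, E)) (v := f)
    (contMDiff_vectorSpace_iff_contDiff.2 hf') hε
    (fun y => by
      obtain ⟨γ, h0, hγ⟩ := hf.exists_local_solution y
      exact ⟨γ, h0, fun t ht => (hγ t ht).hasFDerivAt.hasFDerivWithinAt.hasMFDerivWithinAt⟩) x₀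
  refine ⟨γ, fun t _ => ?_, h0⟩
  have h : HasFDerivAt γ ((1 : ℝ →L[ℝ] ℝ).smulRight (f (γ t))) t := (hγ t).hasFDerivAt
  simpa using h.hasDerivAt.hasDerivWithinAt

theorem IsSolution.continuousOn {f : E → E} {x : ℝ → E} (hx : IsSolution f x) :
    ContinuousOn x (Set.Ici 0) := fun t ht => (hx t ht).continuousWithinAt

/-- `L` decreases along the solutions of `ẋ = f x` at least at the rate `ψ`. -/
def DecreasesAlong (f : E → E) (L ψ : E → ℝ) : Prop :=
  ∀ x : ℝ → E, IsSolution f x → ∀ t : ℝ, 0 ≤ t →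
    ∃ l : ℝ, l ≤ -ψ (x t) ∧ HasDerivWithinAt (fun τ => L (x τ)) l (Set.Ici 0) t

/-- Mean value estimate: a Lyapunov function which decreases at a rate at least `c` on `[0, T]`. -/
theorem DecreasesAlong.le_sub {f : E → E} {L ψ : E → ℝ} (h : DecreasesAlong f L ψ) {x : ℝ → E}
    (hx : IsSolution f x) {T c : ℝ} (hT : 0 ≤ T) (hc : ∀ t ∈ Set.Icc 0 T, c ≤ ψ (x t)) :
    L (x T) ≤ L (x 0) - c * T := by
  choose! l hl hd using h x hx
  have := image_le_of_deriv_right_le_deriv_boundary (f := fun τ => L (x τ)) (f' := l)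
    (a := 0) (b := T) (B := fun t => L (x 0) - c * t) (B' := fun _ => -c)
    (fun t ht => (hd t ht.1).continuousWithinAt.mono Set.Icc_subset_Ici_self)
    (fun t ht => (hd t ht.1).mono (Set.Ici_subset_Ici.2 ht.1))
    (by simp) (by fun_prop)
    (fun t _ => by
      have : HasDerivAt (fun t : ℝ => L (x 0) - c * t) (-(c * 1)) t :=
        ((hasDerivAt_id t).const_mul c).const_sub _
      simpa using this.hasDerivWithinAt)
    (fun t ht => (hl t ht.1).trans (neg_le_neg (hc t ⟨ht.1, ht.2.le⟩)))
  exact this (Set.right_mem_Icc.2 hT)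

/-- Lyapunov stability from a nonincreasing locally positive definite function. -/
theorem DecreasesAlong.stable [ProperSpace E] {f : E → E} {xs : E} {L : E → ℝ}
    (hL : Continuous L) (hpos : ∀ᶠ x in 𝓝 xs, x ≠ xs → L xs < L x)
    (hdec : DecreasesAlong f L 0) {ε : ℝ} (hε : 0 < ε) :
    ∃ δ : ℝ, 0 < δ ∧ ∀ x : ℝ → E, IsSolution f x → ‖x 0 - xs‖ < δ →
      ∀ t : ℝ, 0 ≤ t → ‖x t - xs‖ < ε := by
  obtain ⟨R, hR, hball⟩ := Metric.eventually_nhds_iff.1 hpos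
  obtain ⟨r, hr, hrR, hrε⟩ : ∃ r : ℝ, 0 < r ∧ r < R ∧ r < ε :=
    ⟨min R ε / 2, by positivity, by linarith [min_le_left R ε, lt_min hR hε],
      by linarith [min_le_right R ε, lt_min hR hε]⟩
  -- `m` is a barrier on the sphere; the sphere is empty in the zero space, where any larger number
  -- serves.
  obtain ⟨m, hm, hsph⟩ : ∃ m : ℝ, L xs < m ∧ ∀ y ∈ Metric.sphere xs r, m ≤ L y := by
    rcases (Metric.sphere xs r).eq_empty_or_nonempty with he | hne
    · exact ⟨L xs + 1, by linarith, by simp [he]⟩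
    · obtain ⟨y, hy, hmin⟩ := (isCompact_sphere xs r).exists_isMinOn hne hL.continuousOn
      have hy' : dist y xs = r := hy
      refine ⟨L y, hball (by rw [hy']; exact hrR) ?_, fun z hz => hmin hz⟩
      rintro rfl
      simp at hy'
      linarith
  obtain ⟨δ, hδ, hδL⟩ := Metric.eventually_nhds_iff.1 (hL.continuousAt.eventually (gt_mem_nhds hm))
  refine ⟨min δ r, lt_min hδ hr, fun x hx h0 t ht => ?_⟩
  have hcont : ContinuousOn (fun s => ‖x s - xs‖) (Set.Ici 0) :=
    (hx.continuousOn.sub continuousOn_const).norm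
  by_contra! hcon
  -- The least element of `S` is the first exit time. By continuity it lies on the sphere, where `L`
  -- is at least `m`, although `L` started below `m`.
  set S : Set ℝ := Set.Icc 0 t ∩ (fun s => ‖x s - xs‖) ⁻¹' Set.Ici r with hS
  have hcS : IsCompact S := isCompact_Icc.of_isClosed_subset
    ((hcont.mono Set.Icc_subset_Ici_self).preimage_isClosed_of_isClosed isClosed_Icc isClosed_Ici)
    Set.inter_subset_left
  obtain ⟨t₁, ht₁, hleast⟩ := hcS.exists_isLeast ⟨t, ⟨ht, le_rfl⟩, hrε.le.trans hcon⟩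
  have ht₁0 : 0 ≤ t₁ := ht₁.1.1
  have hlt : ∀ s, 0 ≤ s → s < t₁ → ‖x s - xs‖ < r := by
    intro s hs hst
    by_contra! hc
    exact absurd (hleast ⟨⟨hs, hst.le.trans ht₁.1.2⟩, hc⟩) (not_le.2 hst)
  have ht₁r : r ≤ ‖x t₁ - xs‖ := ht₁.2
  have hpos₁ : 0 < t₁ := by
    rcases ht₁0.eq_or_lt with h | h
    · rw [← h] at ht₁r
      exact absurd (h0.trans_le (min_le_right _ _)) (not_lt.2 ht₁r)
    · exact h
  have hle : ‖x t₁ - xs‖ ≤ r := by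
    have hc1 : ContinuousWithinAt (fun s => ‖x s - xs‖) (Set.Ico 0 t₁) t₁ :=
      (hcont t₁ ht₁0).mono Set.Ico_subset_Ici_self
    have : (𝓝[Set.Ico 0 t₁] t₁).NeBot := by
      apply mem_closure_iff_nhdsWithin_neBot.1
      rw [closure_Ico hpos₁.ne]
      exact Set.right_mem_Icc.2 hpos₁.le
    exact le_of_tendsto hc1 (Filter.eventually_of_mem self_mem_nhdsWithin
      fun s hs => (hlt s hs.1 hs.2).le)
  have hmL : m ≤ L (x t₁) := hsph _ (by
    rw [mem_sphere_iff_norm]; exact le_antisymm hle ht₁r)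
  have hL0 : L (x 0) < m := hδL (by
    rw [dist_eq_norm]; exact h0.trans_le (min_le_left _ _))
  have := hdec.le_sub hx ht₁0 (c := 0) (by simp)
  linarith

/-- Lyapunov's direct method with two functions: `L₀` gives stability, `L₁` (of no particular
sign) gives attractivity. -/
theorem asymptoticallyStable_of_lyapunov [ProperSpace E] [CompleteSpace E]
    {f : E → E} {xs : E} {K : NNReal}
    (hf : LipschitzWith K f) (hf' : ContDiff ℝ 1 f) (hxs : f xs = 0) {L₀ L₁ ψ : E → ℝ}
    (hL₀ : Continuous L₀) (hL₁ : Continuous L₁) (hψ : Continuous ψ)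
    (hpos : ∀ᶠ x in 𝓝 xs, x ≠ xs → L₀ xs < L₀ x) (hψpos : ∀ᶠ x in 𝓝 xs, x ≠ xs → 0 < ψ x)
    (hdec₀ : DecreasesAlong f L₀ 0) (hdec₁ : DecreasesAlong f L₁ ψ) :
    AsymptoticallyStable f xs := by
  refine ⟨hxs, fun ε hε => hdec₀.stable hL₀ hpos hε, ?_⟩
  obtain ⟨R, hR, hball⟩ := Metric.eventually_nhds_iff.1 hψpos
  obtain ⟨δ, hδ, hstab⟩ := hdec₀.stable hL₀ hpos (half_pos hR)
  refine ⟨δ, hδ, fun x₀ hx₀ => ⟨hf.exists_isSolution hf' x₀, fun x hx h0 => ?_⟩⟩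
  have hin : ∀ t, 0 ≤ t → ‖x t - xs‖ < R / 2 := hstab x hx (by rwa [h0])
  rw [Metric.tendsto_atTop]
  intro ε hε
  obtain ⟨η, hη, hstab'⟩ := hdec₀.stable hL₀ hpos hε
  -- By stability, one visit to the `η`-ball is enough. A solution avoiding it stays in a compact
  -- shell on which `ψ` has a positive minimum, so `L₁` would fall linearly below its own minimum
  -- there; no sign of `L₁` is needed.
  obtain ⟨T, hT, hTη⟩ : ∃ T : ℝ, 0 ≤ T ∧ ‖x T - xs‖ < η := by
    by_contra! hcon
    set S : Set E := Metric.closedBall xs (R / 2) ∩ (Metric.ball xs η)ᶜ with hS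
    have hcS : IsCompact S :=
      (isCompact_closedBall xs (R / 2)).inter_right Metric.isOpen_ball.isClosed_compl
    have hmem : ∀ t, 0 ≤ t → x t ∈ S := fun t ht =>
      ⟨by rw [mem_closedBall_iff_norm]; exact (hin t ht).le,
        by rw [Set.mem_compl_iff, mem_ball_iff_norm, not_lt]; exact hcon t ht⟩
    obtain ⟨y, hy, hmin⟩ := hcS.exists_isMinOn ⟨x 0, hmem 0 le_rfl⟩ hψ.continuousOn
    obtain ⟨z, -, hmin'⟩ := hcS.exists_isMinOn ⟨x 0, hmem 0 le_rfl⟩ hL₁.continuousOn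
    have hc : 0 < ψ y := by
      apply hball
      · have := hy.1
        rw [Metric.mem_closedBall] at this
        linarith
      · rintro rfl
        exact hy.2 (Metric.mem_ball_self hη)
    obtain ⟨T, hT⟩ : ∃ T : ℝ, 0 ≤ T ∧ L₁ (x 0) - ψ y * T < L₁ z := by
      refine ⟨(|L₁ (x 0) - L₁ z| + 1) / ψ y, by positivity, ?_⟩
      rw [mul_div_cancel₀ _ hc.ne']
      linarith [le_abs_self (L₁ (x 0) - L₁ z)]
    have h1 := hdec₁.le_sub hx hT.1 (c := ψ y) (fun t ht => hmin (hmem t ht.1))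
    have h2 : L₁ z ≤ L₁ (x T) := hmin' (hmem T hT.1)
    linarith [hT.2]
  refine ⟨T, fun t ht => ?_⟩
  have hshift : IsSolution f (fun s => x (s + T)) := by
    intro s hs
    have := hx (s + T) (by positivity)
    have h2 := this.scomp s (t' := Set.Ici 0) (h := fun s => s + T) (h' := 1)
      ((hasDerivWithinAt_id _ _).add_const T) (fun u hu => add_nonneg hu hT)
    simpa using! h2
  have := hstab' _ hshift (by simpa using hTη) (t - T) (by linarith)
  rw [dist_eq_norm]
  simpa using this

end Dynamics

/-! ### A quadratic Lyapunov function for a Hurwitz matrix -/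

section LyapunovEquation

open Matrix

variable {ι : Type*} [Fintype ι]

/-- Gelfand's formula: the norms of the powers are eventually below `r ^ n` with `r < 1`. Stating
the limit entrywise keeps the auxiliary matrix norm local. -/
theorem Matrix.tendsto_pow_zero_of_spectrum_lt_one [DecidableEq ι] [Nonempty ι] {B : Matrix ι ι ℂ}
    (hB : ∀ μ ∈ spectrum ℂ B, ‖μ‖ < 1) (i j : ι) :
    Filter.Tendsto (fun n : ℕ => (B ^ n) i j) Filter.atTop (𝓝 0) := by
  let _ : NormedRing (Matrix ι ι ℂ) := Matrix.linftyOpNormedRing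
  let _ : NormedAlgebra ℂ (Matrix ι ι ℂ) := Matrix.linftyOpNormedAlgebra
  have hρ : spectralRadius ℂ B < 1 := by
    have := spectrum.spectralRadius_lt_of_forall_lt B (r := 1) (fun μ hμ => by
      exact_mod_cast hB μ hμ)
    simpa using this
  obtain ⟨r, hr, hr1⟩ := ENNReal.lt_iff_exists_nnreal_btwn.1 hρ
  have hr1' : r < 1 := by exact_mod_cast hr1
  have hlim := spectrum.pow_nnnorm_pow_one_div_tendsto_nhds_spectralRadius B
  have hev : ∀ᶠ n : ℕ in Filter.atTop, ‖(B ^ n) i j‖ ≤ (r : ℝ) ^ n := by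
    filter_upwards [hlim.eventually (gt_mem_nhds hr), Filter.eventually_gt_atTop 0] with n hn hn0
    have hn0' : (0 : ℝ) < n := by exact_mod_cast hn0
    have h1 : (‖B ^ n‖₊ : ENNReal) < (r : ENNReal) ^ n := by
      have := ENNReal.rpow_lt_rpow hn hn0'
      rw [← ENNReal.rpow_mul, one_div, inv_mul_cancel₀ hn0'.ne', ENNReal.rpow_one,
        ENNReal.rpow_natCast] at this
      exact this
    have h2 : ‖B ^ n‖₊ < r ^ n := by exact_mod_cast h1
    have h3 : ‖(B ^ n) i j‖₊ ≤ ‖B ^ n‖₊ := by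
      rw [Matrix.linfty_opNNNorm_def]
      exact (Finset.single_le_sum (f := fun j => ‖(B ^ n) i j‖₊) (fun _ _ => zero_le)
        (Finset.mem_univ j)).trans
        (Finset.le_sup (f := fun i => ∑ j, ‖(B ^ n) i j‖₊) (Finset.mem_univ i))
    exact_mod_cast h3.trans h2.le
  exact squeeze_zero_norm' hev (tendsto_pow_atTop_nhds_zero_of_lt_one r.2 (by exact_mod_cast hr1'))

/-- Cauchy–Schwarz in each row; the Frobenius norm stands in for an operator norm. -/
theorem Matrix.dotProduct_mulVec_self_le {κ : Type*} [Fintype κ] (M : Matrix κ ι ℝ) (v : ι → ℝ) :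
    (M *ᵥ v) ⬝ᵥ (M *ᵥ v) ≤ (∑ i, ∑ j, M i j ^ 2) * (v ⬝ᵥ v) := by
  simp only [dotProduct, mulVec, Finset.sum_mul]
  refine Finset.sum_le_sum fun i _ => ?_
  have := Finset.sum_mul_sq_le_sq_mul_sq Finset.univ (fun j => M i j) v
  simpa [pow_two, Finset.sum_mul] using this

variable [DecidableEq ι]

theorem Hurwitz.isUnit_sub {A : Matrix ι ι ℝ} (hA : Hurwitz A) {μ : ℂ} (hμ : 0 ≤ μ.re) :
    IsUnit (μ • (1 : Matrix ι ι ℂ) - A.map Complex.ofReal) := by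
  by_contra h
  have : μ ∈ spectrum ℂ (A.map Complex.ofReal) := by
    rw [spectrum.mem_iff, Algebra.algebraMap_eq_smul_one]
    exact h
  exact absurd (hA μ this) (not_lt.2 hμ)

theorem Matrix.isUnit_of_isUnit_map_ofReal {A : Matrix ι ι ℝ}
    (h : IsUnit (A.map Complex.ofReal)) : IsUnit A := by
  rw [Matrix.isUnit_iff_isUnit_det] at h ⊢
  have hdet : (A.map Complex.ofReal).det = Complex.ofReal A.det :=
    (RingHom.map_det Complex.ofRealHom A).symm
  rw [hdet, isUnit_iff_ne_zero] at h
  rw [isUnit_iff_ne_zero]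
  exact fun h0 => h (by simp [h0])

theorem Hurwitz.isUnit {A : Matrix ι ι ℝ} (hA : Hurwitz A) : IsUnit A := by
  have := hA.isUnit_sub (μ := 0) le_rfl
  rw [zero_smul, zero_sub, IsUnit.neg_iff] at this
  exact isUnit_of_isUnit_map_ofReal this

/-- The Cayley transform of a Hurwitz matrix has its spectrum in the open unit disc. -/
theorem Hurwitz.exists_cayley {A : Matrix ι ι ℝ} (hA : Hurwitz A) :
    IsUnit (A - 1) ∧ ∃ B : Matrix ι ι ℝ, B * (A - 1) = A + 1 ∧
      ∀ μ ∈ spectrum ℂ (B.map Complex.ofReal), ‖μ‖ < 1 := by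
  have hmap : ∀ X : Matrix ι ι ℝ, X.map Complex.ofReal = Complex.ofRealHom.mapMatrix X :=
    fun _ => rfl
  have hFc : IsUnit (A.map Complex.ofReal - 1) := by
    have := hA.isUnit_sub (μ := 1) (by simp)
    rw [one_smul] at this
    simpa using this.neg
  have hF : IsUnit (A - 1) := isUnit_of_isUnit_map_ofReal (by
    rw [hmap, map_sub, map_one]; exact hFc)
  have hB : (A + 1) * (A - 1)⁻¹ * (A - 1) = A + 1 := by
    rw [Matrix.mul_assoc, Matrix.nonsing_inv_mul _ ((Matrix.isUnit_iff_isUnit_det _).1 hF),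
      Matrix.mul_one]
  refine ⟨hF, (A + 1) * (A - 1)⁻¹, hB, fun μ hμ => ?_⟩
  set B := (A + 1) * (A - 1)⁻¹
  by_contra! hnorm
  have hBc : B.map Complex.ofReal * (A.map Complex.ofReal - 1) = A.map Complex.ofReal + 1 := by
    have := congrArg (Complex.ofRealHom.mapMatrix) hB
    rwa [map_mul, map_sub, map_add, map_one] at this
  set Ac := A.map Complex.ofReal
  set Bc := B.map Complex.ofReal
  rw [spectrum.mem_iff, Algebra.algebraMap_eq_smul_one] at hμ
  apply hμ
  -- For `μ ≠ 1`, singularity would make `(μ + 1) / (μ - 1)` an eigenvalue of `A`. Its real part is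
  -- `(|μ|² - 1) / |μ - 1|²`, nonnegative when `|μ| ≥ 1`. For `μ = 1` the product is `-2`.
  have hprod : (μ • (1 : Matrix ι ι ℂ) - Bc) * (Ac - 1) = (μ - 1) • Ac - (μ + 1) • 1 := by
    rw [sub_mul, hBc, smul_mul_assoc, one_mul]
    module
  have hunit : IsUnit ((μ • (1 : Matrix ι ι ℂ) - Bc) * (Ac - 1)) := by
    rw [hprod]
    rcases eq_or_ne μ 1 with rfl | hμ1
    · rw [sub_self, zero_smul, zero_sub, IsUnit.neg_iff]
      have h2 := (IsUnit.mk0 (1 + 1 : ℂ) (by norm_num)).map (algebraMap ℂ (Matrix ι ι ℂ))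
      rwa [Algebra.algebraMap_eq_smul_one] at h2
    · have hμ1' : μ - 1 ≠ 0 := sub_ne_zero.2 hμ1
      have hre : 0 ≤ ((μ + 1) / (μ - 1)).re := by
        rw [Complex.div_re, ← add_div]
        refine div_nonneg ?_ (Complex.normSq_nonneg _)
        have h2 : 1 ≤ Complex.normSq μ := by
          rw [Complex.normSq_eq_norm_sq]; nlinarith
        rw [Complex.normSq_apply] at h2
        simp
        nlinarith
      have := (hA.isUnit_sub hre).neg
      have h3 := (IsUnit.mk0 (μ - 1) hμ1').map (algebraMap ℂ (Matrix ι ι ℂ))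
      have h4 := h3.mul this
      rw [Algebra.algebraMap_eq_smul_one, smul_mul_assoc, one_mul, neg_sub, smul_sub, smul_smul,
        mul_div_cancel₀ _ hμ1'] at h4
      exact h4
  have hcomm := hunit.mul (hFc.unit⁻¹).isUnit
  rwa [mul_assoc, IsUnit.mul_val_inv, mul_one] at hcomm

/-- The Cayley transform `B` replaces the integral of matrix exponentials by a sum over powers of
`B`. Since only an inequality is wanted, the sum can be finite: it telescopes to `‖Bⁿv‖² - ‖v‖²`,
which is at most `-‖v‖² / 2` for suitable `n`. -/
theorem Hurwitz.exists_lyapunov [Nonempty ι] {A : Matrix ι ι ℝ} (hA : Hurwitz A) :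
    ∃ P : Matrix ι ι ℝ, P.IsSymm ∧ (∀ v, v ⬝ᵥ v ≤ v ⬝ᵥ P *ᵥ v) ∧
      ∃ c : ℝ, 0 < c ∧ ∀ v, 2 * (v ⬝ᵥ P *ᵥ (A *ᵥ v)) ≤ -(c * (v ⬝ᵥ v)) := by
  obtain ⟨hF, B, hB, hspec⟩ := hA.exists_cayley
  have hpow : ∀ n i j, ((B ^ n) i j : ℂ) = ((B.map Complex.ofReal) ^ n) i j := by
    intro n i j
    have := map_pow (Complex.ofRealHom.mapMatrix (m := ι)) B n
    exact congrFun (congrFun this i) j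
  have hlim : Filter.Tendsto (fun n : ℕ => ∑ i, ∑ j, (B ^ n) i j ^ 2) Filter.atTop (𝓝 0) := by
    have : ∀ i j, Filter.Tendsto (fun n : ℕ => (B ^ n) i j) Filter.atTop (𝓝 0) := by
      intro i j
      have := Matrix.tendsto_pow_zero_of_spectrum_lt_one hspec i j
      simp_rw [← hpow] at this
      simpa using! (Complex.continuous_re.tendsto 0).comp this
    have h := tendsto_finsetSum Finset.univ fun i _ =>
      tendsto_finsetSum Finset.univ fun j _ => (this i j).pow 2
    simpa using h
  -- `n ≥ 1` ensures that the summand `k = 0` is present, which gives the lower bound by the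
  -- identity.
  obtain ⟨n, hn, hn1⟩ := ((hlim.eventually (gt_mem_nhds (show (0 : ℝ) < 1 / 2 by norm_num))).and
    (Filter.eventually_ge_atTop 1)).exists
  set P : Matrix ι ι ℝ := ∑ k ∈ Finset.range n, (B ^ k)ᵀ * B ^ k with hP
  have hPq : ∀ v w : ι → ℝ, v ⬝ᵥ P *ᵥ w = ∑ k ∈ Finset.range n, (B ^ k *ᵥ v) ⬝ᵥ (B ^ k *ᵥ w) := by
    intro v w
    rw [hP, Matrix.sum_mulVec, dotProduct_sum]
    refine Finset.sum_congr rfl fun k _ => ?_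
    rw [← Matrix.mulVec_mulVec, Matrix.dotProduct_mulVec, Matrix.vecMul_transpose]
  have hstein : ∀ v, (B *ᵥ v) ⬝ᵥ P *ᵥ (B *ᵥ v) - v ⬝ᵥ P *ᵥ v ≤ -(1 / 2 * (v ⬝ᵥ v)) := by
    intro v
    rw [hPq, hPq, ← Finset.sum_sub_distrib]
    have : ∀ k ∈ Finset.range n, (B ^ k *ᵥ B *ᵥ v) ⬝ᵥ (B ^ k *ᵥ B *ᵥ v)
        - (B ^ k *ᵥ v) ⬝ᵥ (B ^ k *ᵥ v) = (B ^ (k + 1) *ᵥ v) ⬝ᵥ (B ^ (k + 1) *ᵥ v)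
        - (B ^ k *ᵥ v) ⬝ᵥ (B ^ k *ᵥ v) := by
      intro k _
      rw [Matrix.mulVec_mulVec, pow_succ]
    rw [Finset.sum_congr rfl this,
      Finset.sum_range_sub (fun k => (B ^ k *ᵥ v) ⬝ᵥ (B ^ k *ᵥ v))]
    have h1 := Matrix.dotProduct_mulVec_self_le (B ^ n) v
    have h2 : 0 ≤ v ⬝ᵥ v := Finset.sum_nonneg fun i _ => mul_self_nonneg (v i)
    have h3 : (∑ i, ∑ j, (B ^ n) i j ^ 2) * (v ⬝ᵥ v) ≤ 1 / 2 * (v ⬝ᵥ v) := by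
      gcongr
    simp only [pow_zero, Matrix.one_mulVec]
    linarith
  have hsymm : P.IsSymm := by
    rw [Matrix.IsSymm, hP, Matrix.transpose_sum]
    refine Finset.sum_congr rfl fun k _ => ?_
    rw [Matrix.transpose_mul, Matrix.transpose_transpose]
  have hcross : ∀ v w : ι → ℝ, v ⬝ᵥ P *ᵥ w = w ⬝ᵥ P *ᵥ v := by
    intro v w
    rw [hPq, hPq]
    exact Finset.sum_congr rfl fun k _ => dotProduct_comm _ _
  refine ⟨P, hsymm, fun v => ?_, ?_⟩
  · rw [hPq]
    have := Finset.single_le_sum (f := fun k => (B ^ k *ᵥ v) ⬝ᵥ (B ^ k *ᵥ v))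
      (fun k _ => Finset.sum_nonneg fun i _ => mul_self_nonneg ((B ^ k *ᵥ v) i))
      (Finset.mem_range.2 (Nat.lt_of_lt_of_le Nat.zero_lt_one hn1))
    simpa using this
  · set G := (A - 1)⁻¹
    have hG : ∀ v, G *ᵥ ((A - 1) *ᵥ v) = v := by
      intro v
      rw [Matrix.mulVec_mulVec, Matrix.nonsing_inv_mul _ ((Matrix.isUnit_iff_isUnit_det _).1 hF),
        Matrix.one_mulVec]
    set s := ∑ i, ∑ j, G i j ^ 2
    have hs : 0 ≤ s := Finset.sum_nonneg fun i _ => Finset.sum_nonneg fun j _ => sq_nonneg _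
    refine ⟨1 / (4 * (s + 1)), by positivity, fun v => ?_⟩
    -- Since `B (A - 1) = A + 1`, the discrete inequality at `(A - 1) v` becomes, after
    -- polarization, one for `4 vᵀ P A v`. The decay is in terms of `(A - 1) v`; the bound on `(A -
    -- 1)⁻¹` turns it into decay in terms of `v`.
    have h1 := hstein ((A - 1) *ᵥ v)
    rw [Matrix.mulVec_mulVec, hB, Matrix.add_mulVec, Matrix.sub_mulVec, Matrix.one_mulVec] at h1
    have h2 := Matrix.dotProduct_mulVec_self_le G ((A - 1) *ᵥ v)
    rw [hG] at h2
    rw [Matrix.sub_mulVec, Matrix.one_mulVec] at h2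
    set w := A *ᵥ v
    have h3 : (w + v) ⬝ᵥ P *ᵥ (w + v) - (w - v) ⬝ᵥ P *ᵥ (w - v) = 4 * (v ⬝ᵥ P *ᵥ w) := by
      simp only [Matrix.mulVec_add, Matrix.mulVec_sub, add_dotProduct, sub_dotProduct,
        dotProduct_add, dotProduct_sub]
      rw [hcross w v]
      ring
    rw [h3] at h1
    have h4 : 0 ≤ (w - v) ⬝ᵥ (w - v) := Finset.sum_nonneg fun i _ => mul_self_nonneg ((w - v) i)
    have h5 : v ⬝ᵥ v ≤ (s + 1) * ((w - v) ⬝ᵥ (w - v)) := by linarith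
    have h6 : 1 / (4 * (s + 1)) * (v ⬝ᵥ v) ≤ 1 / 4 * ((w - v) ⬝ᵥ (w - v)) := by
      rw [div_mul_eq_mul_div, div_le_iff₀ (by positivity)]
      linarith
    linarith

end LyapunovEquation

/-! ### Linear systems and minimality of storage functions -/

section LinearSystems

open Matrix

variable {ι : Type*} [Fintype ι]

theorem HasDerivWithinAt.mulVec {κ : Type*} {x : ℝ → ι → ℝ} {v : ι → ℝ} {S : Set ℝ} {t : ℝ}
    (h : HasDerivWithinAt x v S t) (M : Matrix κ ι ℝ) :
    HasDerivWithinAt (fun τ => M *ᵥ x τ) (M *ᵥ v) S t :=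
  hasDerivWithinAt_pi.2 fun _ => HasDerivWithinAt.fun_sum fun j _ =>
    (hasDerivWithinAt_pi.1 h j).const_mul _

theorem HasDerivWithinAt.dotProduct_mulVec_self {x : ℝ → ι → ℝ} {v : ι → ℝ} {S : Set ℝ} {t : ℝ}
    (h : HasDerivWithinAt x v S t) {P : Matrix ι ι ℝ} (hP : P.IsSymm) (xs : ι → ℝ) :
    HasDerivWithinAt (fun τ => (x τ - xs) ⬝ᵥ P *ᵥ (x τ - xs))
      (2 * ((x t - xs) ⬝ᵥ P *ᵥ v)) S t := by
  have h1 := h.sub_const xs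
  have h2 := h1.mulVec P
  have h3 := HasDerivWithinAt.fun_sum (u := Finset.univ) fun j _ =>
    (hasDerivWithinAt_pi.1 h1 j).mul (hasDerivWithinAt_pi.1 h2 j)
  convert! h3 using 1
  have h4 : v ⬝ᵥ P *ᵥ (x t - xs) = (x t - xs) ⬝ᵥ P *ᵥ v := by
    rw [dotProduct_comm, Matrix.dotProduct_mulVec, ← Matrix.mulVec_transpose, hP.eq]
  rw [Finset.sum_add_distrib]
  change _ = v ⬝ᵥ P *ᵥ (x t - xs) + (x t - xs) ⬝ᵥ P *ᵥ v
  rw [h4, two_mul]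

theorem Matrix.dotProduct_self_nonneg_real (v : ι → ℝ) : 0 ≤ v ⬝ᵥ v :=
  Finset.sum_nonneg fun i _ => mul_self_nonneg (v i)

theorem Matrix.dotProduct_self_pos_real {v : ι → ℝ} (hv : v ≠ 0) : 0 < v ⬝ᵥ v :=
  (dotProduct_self_nonneg_real v).lt_of_ne fun h => hv (dotProduct_self_eq_zero.1 h.symm)

theorem Matrix.exists_lipschitzWith_mulVec {κ : Type*} [Fintype κ] (M : Matrix κ ι ℝ) :
    ∃ K : NNReal, LipschitzWith K fun v : ι → ℝ => M *ᵥ v :=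
  ⟨_, (LinearMap.toContinuousLinearMap M.mulVecLin).lipschitz⟩

theorem Matrix.contDiff_mulVec {κ : Type*} [Fintype κ] (M : Matrix κ ι ℝ) {n : WithTop ℕ∞} :
    ContDiff ℝ n fun v : ι → ℝ => M *ᵥ v :=
  (LinearMap.toContinuousLinearMap M.mulVecLin).contDiff

/-- A `C¹` function does not increase along the solutions of an equation if its derivative along
the vector field is nonpositive. -/
theorem decreasesAlong_of_fderiv_nonpos {E : Type*} [NormedAddCommGroup E] [NormedSpace ℝ E]
    {f : E → E} {V : E → ℝ} (hV : Differentiable ℝ V) (h : ∀ x, fderiv ℝ V x (f x) ≤ 0) :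
    DecreasesAlong f V 0 := fun x hx t ht =>
  ⟨_, by simpa using h (x t), (hV (x t)).hasFDerivAt.comp_hasDerivWithinAt t (hx t ht)⟩

/-- Along an asymptotically stable system, a nonincreasing continuous function is minimal at the
equilibrium, locally. -/
theorem AsymptoticallyStable.eventually_le {E : Type*} [NormedAddCommGroup E] [NormedSpace ℝ E]
    {f : E → E} {xs : E} (hs : AsymptoticallyStable f xs) {V : E → ℝ} (hV : Continuous V)
    (hdec : DecreasesAlong f V 0) : ∀ᶠ x in 𝓝 xs, V xs ≤ V x := by
  obtain ⟨-, -, δ, hδ, h⟩ := hs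
  refine Metric.eventually_nhds_iff.2 ⟨δ, hδ, fun x₀ hx₀ => ?_⟩
  rw [dist_eq_norm] at hx₀
  obtain ⟨⟨x, hx, rfl⟩, hlim⟩ := h x₀ hx₀
  refine le_of_tendsto ((hV.tendsto xs).comp (hlim x hx rfl))
    (Filter.eventually_atTop.2 ⟨0, fun T hT => ?_⟩)
  simpa using hdec.le_sub hx hT (c := 0) (by simp)

/-- The quadratic form of `P` plays both Lyapunov roles. The conclusion is in the form needed by
`AsymptoticallyStable.eventually_le`. -/
theorem Hurwitz.asymptoticallyStable [DecidableEq ι] [Nonempty ι] {A : Matrix ι ι ℝ}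
    (hA : Hurwitz A) (xs : ι → ℝ) : AsymptoticallyStable (fun x => A *ᵥ (x - xs)) xs := by
  obtain ⟨P, hP, hPpos, c, hc, hPA⟩ := hA.exists_lyapunov
  obtain ⟨K, hK⟩ := A.exists_lipschitzWith_mulVec
  have hpos : ∀ x, x ≠ xs → 0 < (x - xs) ⬝ᵥ (x - xs) := fun x hx =>
    dotProduct_self_pos_real (sub_ne_zero.2 hx)
  have hcont : Continuous fun x : ι → ℝ => (x - xs) ⬝ᵥ P *ᵥ (x - xs) :=
    (continuous_id.sub continuous_const).dotProduct
      (continuous_const.matrix_mulVec (continuous_id.sub continuous_const))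
  have hdec : DecreasesAlong (fun x => A *ᵥ (x - xs)) (fun x => (x - xs) ⬝ᵥ P *ᵥ (x - xs))
      (fun x => c * ((x - xs) ⬝ᵥ (x - xs))) := fun x hx t ht =>
    ⟨_, hPA _, (hx t ht).dotProduct_mulVec_self hP xs⟩
  refine asymptoticallyStable_of_lyapunov (K := K * (1 + 0)) (ψ := fun x => c * ((x - xs) ⬝ᵥ (x - xs)))
    (hK.comp (LipschitzWith.id.sub (LipschitzWith.const xs)))
    (A.contDiff_mulVec.comp (contDiff_id.sub contDiff_const)) (by simp) hcont hcont
    (continuous_const.mul ((continuous_id.sub continuous_const).dotProduct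
      (continuous_id.sub continuous_const)))
    (Filter.Eventually.of_forall fun x hx => ?_)
    (Filter.Eventually.of_forall fun x hx => mul_pos hc (hpos x hx)) ?_ hdec
  · simpa using (hpos x hx).trans_le (hPpos (x - xs))
  · intro x hx t ht
    obtain ⟨l, hl, hd⟩ := hdec x hx t ht
    refine ⟨l, hl.trans ?_, hd⟩
    simpa using mul_nonneg hc.le (dotProduct_self_nonneg_real (x t - xs))

/-- Input-to-state estimate for a Hurwitz matrix. -/
theorem Hurwitz.exists_iss_lyapunov {κ : Type*} [Fintype κ] [DecidableEq ι] [Nonempty ι] {A : Matrix ι ι ℝ}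
    (hA : Hurwitz A) (B : Matrix ι κ ℝ) :
    ∃ P : Matrix ι ι ℝ, P.IsSymm ∧ (∀ v, v ⬝ᵥ v ≤ v ⬝ᵥ P *ᵥ v) ∧
      ∃ c : ℝ, 0 < c ∧ ∃ C : ℝ, 0 ≤ C ∧ ∀ v u,
        2 * (v ⬝ᵥ P *ᵥ (A *ᵥ v + B *ᵥ u)) ≤ -(c * (v ⬝ᵥ v)) + C * (u ⬝ᵥ u) := by
  obtain ⟨P, hP, hPpos, c, hc, hPA⟩ := hA.exists_lyapunov
  set s := ∑ i, ∑ j, (P * B) i j ^ 2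
  have hs : 0 ≤ s := Finset.sum_nonneg fun i _ => Finset.sum_nonneg fun j _ => sq_nonneg _
  refine ⟨P, hP, hPpos, c / 2, by positivity, 2 * s / c, by positivity, fun v u => ?_⟩
  have h1 := hPA v
  have h2 := Matrix.dotProduct_mulVec_self_le (P * B) u
  rw [Matrix.mulVec_add, dotProduct_add, Matrix.mulVec_mulVec u P B]
  set w := (P * B) *ᵥ u
  -- Young's inequality: dividing this square by `2c` trades the cross term for half of the decay.
  have h3 : 0 ≤ (c • v - (2 : ℝ) • w) ⬝ᵥ (c • v - (2 : ℝ) • w) := dotProduct_self_nonneg_real _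
  simp only [sub_dotProduct, dotProduct_sub, smul_dotProduct, dotProduct_smul, smul_eq_mul,
    dotProduct_comm w v] at h3
  have h4 : 2 * (v ⬝ᵥ w) ≤ c / 2 * (v ⬝ᵥ v) + 2 / c * (w ⬝ᵥ w) := by
    have : 0 ≤ (c * (c * (v ⬝ᵥ v)) - c * (2 * (v ⬝ᵥ w)) - (2 * (c * (v ⬝ᵥ w)) - 2 * (2 * (w ⬝ᵥ w)))) / (2 * c) :=
      div_nonneg (by linarith) (by positivity)
    have h5 : (c * (c * (v ⬝ᵥ v)) - c * (2 * (v ⬝ᵥ w)) - (2 * (c * (v ⬝ᵥ w)) - 2 * (2 * (w ⬝ᵥ w)))) / (2 * c) =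
        c / 2 * (v ⬝ᵥ v) + 2 / c * (w ⬝ᵥ w) - 2 * (v ⬝ᵥ w) := by
      field_simp
      ring
    linarith
  have h5 : 2 / c * (w ⬝ᵥ w) ≤ 2 / c * (s * (u ⬝ᵥ u)) := by gcongr
  have h6 : 2 / c * (s * (u ⬝ᵥ u)) = 2 * s / c * (u ⬝ᵥ u) := by ring
  linarith

end LinearSystems

/-! ### Scalar inequalities and summation by parts -/

section Auxiliary

/-- The Bregman divergence of `-cos` on `(-π/2, π/2)`. -/
theorem Real.cos_bregman_pos {a d : ℝ} (ha : |a| < Real.pi / 2) (hd : |d| < Real.pi / 2)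
    (hne : d ≠ a) : 0 < Real.cos a - Real.cos d - Real.sin a * (d - a) := by
  have hmem : ∀ x : ℝ, |x| < Real.pi / 2 → x ∈ Set.Icc (-(Real.pi / 2)) (Real.pi / 2) :=
    fun x hx => ⟨(abs_lt.1 hx).1.le, (abs_lt.1 hx).2.le⟩
  rcases lt_or_gt_of_ne hne with h | h
  · have := strictConcaveOn_cos_Icc.lt_slope_of_hasDerivAt (hmem d hd) (hmem a ha) h
      (Real.hasDerivAt_cos a)
    rw [slope_def_field, lt_div_iff₀ (by linarith)] at this
    linarith
  · have := strictConcaveOn_cos_Icc.slope_lt_of_hasDerivAt (hmem a ha) (hmem d hd) h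
      (Real.hasDerivAt_cos a)
    rw [slope_def_field, div_lt_iff₀ (by linarith)] at this
    linarith

theorem Real.cos_bregman_nonneg {a d : ℝ} (ha : |a| < Real.pi / 2) (hd : |d| < Real.pi / 2) :
    0 ≤ Real.cos a - Real.cos d - Real.sin a * (d - a) := by
  rcases eq_or_ne d a with rfl | h
  · simp
  · exact (Real.cos_bregman_pos ha hd h).le

theorem Real.sin_sub_sin_mul_pos {a d : ℝ} (ha : |a| < Real.pi / 2) (hd : |d| < Real.pi / 2)
    (hne : d ≠ a) : 0 < (Real.sin d - Real.sin a) * (d - a) := by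
  have hmem : ∀ x : ℝ, |x| < Real.pi / 2 → x ∈ Set.Icc (-(Real.pi / 2)) (Real.pi / 2) :=
    fun x hx => ⟨(abs_lt.1 hx).1.le, (abs_lt.1 hx).2.le⟩
  rcases lt_or_gt_of_ne hne with h | h
  · exact mul_pos_of_neg_of_neg
      (sub_neg.2 (Real.strictMonoOn_sin (hmem d hd) (hmem a ha) h)) (sub_neg.2 h)
  · exact mul_pos (sub_pos.2 (Real.strictMonoOn_sin (hmem a ha) (hmem d hd) h)) (sub_pos.2 h)

theorem Real.sin_sub_sin_mul_nonneg {a d : ℝ} (ha : |a| < Real.pi / 2) (hd : |d| < Real.pi / 2) :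
    0 ≤ (Real.sin d - Real.sin a) * (d - a) := by
  rcases eq_or_ne d a with rfl | h
  · simp
  · exact (Real.sin_sub_sin_mul_pos ha hd h).le

/-- Summation by parts over the ordered pairs of a finite set. -/
theorem Finset.sum_sum_antisymm_mul_sub {n : Type*} [Fintype n] {a : n → n → ℝ}
    (ha : ∀ i j, a j i = -a i j) (w : n → ℝ) :
    ∑ i, ∑ j, a i j * (w i - w j) = 2 * ∑ i, w i * ∑ j, a i j := by
  have h1 : ∑ i, ∑ j, a i j * w j = -∑ i, w i * ∑ j, a i j := by
    rw [Finset.sum_comm, ← Finset.sum_neg_distrib]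
    refine Finset.sum_congr rfl fun j _ => ?_
    rw [Finset.mul_sum, ← Finset.sum_neg_distrib]
    refine Finset.sum_congr rfl fun i _ => ?_
    rw [ha j i]
    ring
  have h2 : ∑ i, ∑ j, a i j * w i = ∑ i, w i * ∑ j, a i j := by
    refine Finset.sum_congr rfl fun i _ => ?_
    rw [Finset.mul_sum]
    exact Finset.sum_congr rfl fun j _ => mul_comm _ _
  simp only [mul_sub, Finset.sum_sub_distrib, h1, h2]
  ring

theorem Finset.sum_sum_antisymm {n : Type*} [Fintype n] {a : n → n → ℝ}
    (ha : ∀ i j, a j i = -a i j) : ∑ i, ∑ j, a i j = 0 := by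
  have := Finset.sum_sum_antisymm_mul_sub ha fun _ => 1
  simp at this
  linarith

theorem Finset.exists_pos_forall_le {n : Type*} [Finite n] {ε : n → ℝ}
    (h : ∀ i, 0 < ε i) : ∃ e : ℝ, 0 < e ∧ ∀ i, e ≤ ε i := by
  cases isEmpty_or_nonempty n
  · exact ⟨1, one_pos, fun i => isEmptyElim i⟩
  · obtain ⟨i, hi⟩ := Finite.exists_min ε
    exact ⟨ε i, h i, hi⟩

/-- The quadratic supply rate of a first-order system with gain `κ` and feedthrough `d` is
positive definite for a suitable weight of the storage. -/
theorem exists_weight_of_feedthrough {d κ : ℝ} (hd : 0 < d) (hκ : 0 < d + κ) :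
    ∃ c : ℝ, 0 < c ∧ ∃ ε : ℝ, 0 < ε ∧ ∀ w z : ℝ,
      -d * w ^ 2 + z * w - c * z ^ 2 - c * κ * (z * w) ≤ -(ε * (w ^ 2 + z ^ 2)) := by
  -- With weight `1 / m` and `u = z / m`, the form is exactly `-(d (w - u)² + (d + κ) u²)`. The
  -- minimum defining `ε` then bounds `w²` through `2 (w - u)² + 2 u²`, and `z²` through `u²`.
  have hm : 0 < κ + 2 * d := by linarith
  set m := κ + 2 * d with hmdef
  have ha : 0 < (d + κ) / m ^ 2 := by positivity
  have hb : 0 < 2 / m ^ 2 + 1 := by positivity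
  refine ⟨1 / m, by positivity, min (d / 2) (((d + κ) / m ^ 2) / (2 / m ^ 2 + 1)), by positivity,
    fun w z => ?_⟩
  set ε := min (d / 2) (((d + κ) / m ^ 2) / (2 / m ^ 2 + 1)) with hε
  have hε0 : 0 < ε := by positivity
  have h1 : ε ≤ d / 2 := min_le_left _ _
  have h2 : ε * (2 / m ^ 2 + 1) ≤ (d + κ) / m ^ 2 := by
    rw [← le_div_iff₀ hb]; exact min_le_right _ _
  set u := z / m with hu
  have hz : z = m * u := by rw [hu]; field_simp
  have h3 : ε * (2 * u ^ 2 + z ^ 2) ≤ (d + κ) * u ^ 2 := by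
    have := mul_le_mul_of_nonneg_right h2 (sq_nonneg z)
    calc ε * (2 * u ^ 2 + z ^ 2) = ε * (2 / m ^ 2 + 1) * z ^ 2 := by rw [hu]; field_simp
      _ ≤ (d + κ) / m ^ 2 * z ^ 2 := this
      _ = (d + κ) * u ^ 2 := by rw [hu]; field_simp
  have h4 : ε * (2 * (w - u) ^ 2) ≤ d * (w - u) ^ 2 := by nlinarith [sq_nonneg (w - u)]
  have h5 : ε * w ^ 2 ≤ ε * (2 * (w - u) ^ 2 + 2 * u ^ 2) := by
    apply mul_le_mul_of_nonneg_left _ hε0.le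
    nlinarith [sq_nonneg (w - 2 * u)]
  have h6 : -d * w ^ 2 + z * w - 1 / m * z ^ 2 - 1 / m * κ * (z * w) =
      -(d * (w - u) ^ 2 + (d + κ) * u ^ 2) := by
    have e1 : 1 / m * z ^ 2 = m * u ^ 2 := by rw [hz]; field_simp
    have e2 : 1 / m * κ * (z * w) = κ * (u * w) := by rw [hz]; field_simp
    rw [e1, e2, hz, hmdef]
    ring
  rw [h6]
  nlinarith

end Auxiliary

/-! ### From the frequency-domain condition to weights -/

namespace EPS

variable {Bus HP : Type*} {r : Bus} [DecidableEq Bus] (eps : EPS Bus HP r)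

/-- AGC gain: it acts at the reference bus only. -/
def agcGain (i : Bus) : ℝ := if i = r then eps.KI else 0

/-- Gain of the fast mode of the controlled turbine-governor at bus `i`. -/
def fastGain (i : Bus) : ℝ := eps.KP i - eps.agcGain i * eps.Tg i

/-- By partial fractions the governor is `KI / s`, purely imaginary on the axis, plus a first-order
term of gain `fastGain`. -/
theorem G_re (i : Bus) {w : ℝ} (hw : i = r → w ≠ 0) :
    (eps.G i (Complex.I * w)).re = eps.D i + eps.fastGain i / (1 + (eps.Tg i * w) ^ 2) := by
  have hT := eps.Tg_pos i
  have h1 : 1 + (eps.Tg i * w) ^ 2 ≠ 0 := by positivity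
  have e1 : ((eps.KP i : ℂ) / ((eps.Tg i : ℂ) * (Complex.I * w) + 1)).re =
      eps.KP i / (1 + (eps.Tg i * w) ^ 2) := by
    rw [Complex.div_re]
    simp [Complex.normSq_apply]
    congr 1
    ring
  by_cases hi : i = r
  · have hw' := hw hi
    have e2 : ((eps.KI : ℂ) / (Complex.I * w * ((eps.Tg i : ℂ) * (Complex.I * w) + 1))).re =
        -(eps.KI * eps.Tg i) / (1 + (eps.Tg i * w) ^ 2) := by
      rw [Complex.div_re]
      have h2 : 1 + eps.Tg i * w * (eps.Tg i * w) ≠ 0 := by rwa [← pow_two]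
      simp [Complex.normSq_apply]
      field_simp
      ring
    simp only [G, if_pos hi, Complex.add_re, Complex.ofReal_re, e1, e2, fastGain, agcGain]
    ring
  · simp only [G, if_neg hi, Complex.add_re, Complex.ofReal_re, e1, fastGain, agcGain,
      Complex.zero_re]
    ring

variable {eps}

theorem DampedSPR.D_pos (h : eps.DampedSPR) (i : Bus) : 0 < eps.D i := by
  obtain ⟨⟨d, hd, hD⟩, -⟩ := h
  exact hd.trans_le (hD i)

/-- The limit at frequency `0` is taken through punctured neighbourhoods, which also covers the pole
at the reference bus; the uniform `ρ` keeps it positive. -/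
theorem DampedSPR.D_add_fastGain_pos (h : eps.DampedSPR) (i : Bus) :
    0 < eps.D i + eps.fastGain i := by
  obtain ⟨ρ, hρ, hG⟩ := h.2 i
  refine hρ.trans_le ?_
  have hlim : Filter.Tendsto (fun w : ℝ => eps.D i + eps.fastGain i / (1 + (eps.Tg i * w) ^ 2))
      (𝓝[≠] 0) (𝓝 (eps.D i + eps.fastGain i / (1 + (eps.Tg i * 0) ^ 2))) := by
    apply Filter.Tendsto.mono_left _ nhdsWithin_le_nhds
    apply ContinuousAt.tendsto
    have : (1 + (eps.Tg i * 0) ^ 2 : ℝ) ≠ 0 := by simp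
    fun_prop (disch := assumption)
  have := ge_of_tendsto hlim (b := ρ) (by
    filter_upwards [self_mem_nhdsWithin] with w hw
    rw [← eps.G_re i fun _ => hw]
    exact hG w fun _ => hw)
  simpa using this

theorem DampedSPR.exists_weights [Finite Bus] (h : eps.DampedSPR) :
    ∃ c : Bus → ℝ, (∀ i, 0 < c i) ∧ ∃ ε : ℝ, 0 < ε ∧ ∀ i, ∀ w z : ℝ,
      -eps.D i * w ^ 2 + z * w - c i * z ^ 2 - c i * eps.fastGain i * (z * w) ≤
        -(ε * (w ^ 2 + z ^ 2)) := by
  choose c hc ε hε hq using fun i => exists_weight_of_feedthrough (h.D_pos i)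
    (h.D_add_fastGain_pos i)
  obtain ⟨e, he, hle⟩ := Finset.exists_pos_forall_le hε
  refine ⟨c, hc, e, he, fun i w z => (hq i w z).trans ?_⟩
  have : e * (w ^ 2 + z ^ 2) ≤ ε i * (w ^ 2 + z ^ 2) := by
    gcongr
    exact hle i
  linarith

end EPS

/-! ### Incremental energy and mismatch of the power system -/

noncomputable section

theorem Finset.eq_zero_of_sum_sum_eq_zero {n : Type*} [Fintype n] {F : n → n → ℝ} (h0 : ∀ i j, 0 ≤ F i j)
    (h : ∑ i, ∑ j, F i j = 0) (i j : n) : F i j = 0 := by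
  have h1 := (Finset.sum_eq_zero_iff_of_nonneg fun i _ =>
    Finset.sum_nonneg fun j _ => h0 i j).1 h i (Finset.mem_univ i)
  exact (Finset.sum_eq_zero_iff_of_nonneg fun j _ => h0 i j).1 h1 j (Finset.mem_univ j)

namespace EPSState

variable {Bus : Type*} {r : Bus}

theorem θ_ref [DecidableEq Bus] (s : EPSState Bus r) : s.θ r = 0 := by simp [θ]

@[fun_prop]
theorem continuous_ω {X : Type*} [TopologicalSpace X] {f : X → EPSState Bus r} (hf : Continuous f)
    (i : Bus) : Continuous fun x => (f x).ω i := by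
  unfold ω; fun_prop

@[fun_prop]
theorem continuous_PG {X : Type*} [TopologicalSpace X] {f : X → EPSState Bus r}
    (hf : Continuous f) (i : Bus) : Continuous fun x => (f x).PG i := by
  unfold PG; fun_prop

@[fun_prop]
theorem continuous_g {X : Type*} [TopologicalSpace X] {f : X → EPSState Bus r}
    (hf : Continuous f) : Continuous fun x => (f x).g := by
  unfold g; fun_prop

@[fun_prop]
theorem continuous_θ [DecidableEq Bus] {X : Type*} [TopologicalSpace X] {f : X → EPSState Bus r}
    (hf : Continuous f) (i : Bus) : Continuous fun x => (f x).θ i := by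
  unfold θ xθ
  split_ifs <;> fun_prop

theorem ext_coords [DecidableEq Bus] {s s' : EPSState Bus r} (hθ : ∀ i, s.θ i = s'.θ i)
    (hω : ∀ i, s.ω i = s'.ω i) (hPG : ∀ i, s.PG i = s'.PG i) (hg : s.g = s'.g) : s = s' := by
  refine Prod.ext ?_ (Prod.ext (funext hω) (Prod.ext (funext hPG) hg))
  funext i
  have := hθ i
  rwa [θ, θ, dif_pos i.2, dif_pos i.2] at this

end EPSState

namespace EPS

variable {Bus HP : Type*} {r : Bus} (eps : EPS Bus HP r)

/-- Gain of the power flow along a line. -/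
def lineGain (i j : Bus) : ℝ := |eps.B i j| * eps.V i * eps.V j

theorem lineGain_symm (i j : Bus) : eps.lineGain j i = eps.lineGain i j := by
  rw [lineGain, lineGain, eps.B_symm j i]
  ring

theorem lineGain_nonneg (i j : Bus) : 0 ≤ eps.lineGain i j :=
  mul_nonneg (mul_nonneg (abs_nonneg _) (eps.V_pos i).le) (eps.V_pos j).le

theorem lineGain_pos {i j : Bus} (h : eps.B i j ≠ 0) : 0 < eps.lineGain i j :=
  mul_pos (mul_pos (abs_pos.2 h) (eps.V_pos i)) (eps.V_pos j)

theorem lineGain_eq_zero {i j : Bus} (h : eps.B i j = 0) : eps.lineGain i j = 0 := by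
  simp [lineGain, h]

variable [DecidableEq Bus]

/-- Deviation of the generation at bus `i` from the AGC signal. -/
def govDev (s : EPSState Bus r) (i : Bus) : ℝ := s.PG i - eps.agcGain i * s.g

/-- Change of the power flow on the line from `i` to `j` with respect to the state `se`. -/
def flowDev (se s : EPSState Bus r) (i j : Bus) : ℝ :=
  eps.lineGain i j * (Real.sin (s.θ i - s.θ j) - Real.sin (se.θ i - se.θ j))

theorem flowDev_antisymm (se s : EPSState Bus r) (i j : Bus) :
    eps.flowDev se s j i = -eps.flowDev se s i j := by
  rw [flowDev, flowDev, lineGain_symm, ← neg_sub (s.θ i), ← neg_sub (se.θ i), Real.sin_neg,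
    Real.sin_neg]
  ring

@[fun_prop]
theorem continuous_govDev {X : Type*} [TopologicalSpace X] {f : X → EPSState Bus r}
    (hf : Continuous f) (i : Bus) : Continuous fun x => eps.govDev (f x) i := by
  unfold govDev; fun_prop

/-- The angle deviation from `se` is constant along walks and vanishes at `r`. -/
theorem θ_eq_of_lines {eps : EPS Bus HP r} (hconn : eps.graph.Connected) {se s : EPSState Bus r}
    (h : ∀ i j, eps.B i j ≠ 0 → s.θ i - s.θ j = se.θ i - se.θ j) (i : Bus) : s.θ i = se.θ i := by
  have hwalk : ∀ {i j : Bus} (_ : eps.graph.Walk i j), s.θ i - se.θ i = s.θ j - se.θ j := by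
    intro i j p
    induction p with
    | nil => rfl
    | @cons u v w huv _ ih =>
      rw [← ih]
      have : eps.B u v ≠ 0 := by
        have := huv
        rw [graph, SimpleGraph.fromRel_adj, eps.B_symm v u, or_self] at this
        exact this.2
      linarith [h u v this]
  obtain ⟨p⟩ := hconn.preconnected i r
  have := hwalk p
  rw [s.θ_ref, se.θ_ref] at this
  linarith

theorem lineEnergy_term_nonneg {eps : EPS Bus HP r} {se s : EPSState Bus r} (hse : eps.Secure se) (hs : eps.Secure s)
    (i j : Bus) : 0 ≤ eps.lineGain i j * (Real.cos (se.θ i - se.θ j) - Real.cos (s.θ i - s.θ j) -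
      Real.sin (se.θ i - se.θ j) * ((s.θ i - s.θ j) - (se.θ i - se.θ j))) := by
  by_cases hB : eps.B i j = 0
  · rw [eps.lineGain_eq_zero hB, zero_mul]
  · exact mul_nonneg (eps.lineGain_nonneg i j)
      (Real.cos_bregman_nonneg (hse i j hB) (hs i j hB))

variable [Fintype Bus]

/-- Mismatch at bus `i` between the power flow and the AGC signal. -/
def mismatch (se s : EPSState Bus r) (i : Bus) : ℝ :=
  ∑ j, eps.flowDev se s i j - eps.agcGain i * (s.g - se.g)

theorem sum_agcGain_mul (f : Bus → ℝ) : ∑ i, eps.agcGain i * f i = eps.KI * f r := by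
  simp [agcGain]

/-- Bregman divergence of the potential energy stored in the lines. -/
def lineEnergy (se s : EPSState Bus r) : ℝ :=
  ∑ i, ∑ j, eps.lineGain i j * (Real.cos (se.θ i - se.θ j) - Real.cos (s.θ i - s.θ j) -
    Real.sin (se.θ i - se.θ j) * ((s.θ i - s.θ j) - (se.θ i - se.θ j)))

/-- Incremental energy of the EPS, the generation modes being weighted by `c`. -/
def energy (c : Bus → ℝ) (se s : EPSState Bus r) : ℝ :=
  ∑ i, eps.M i * s.ω i ^ 2 / 2 + eps.lineEnergy se s / 2 + eps.KI * (s.g - se.g) ^ 2 / 2 +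
    ∑ i, c i * eps.Tg i * eps.govDev s i ^ 2 / 2

/-- Correlation of mismatch and momentum. -/
def crossEnergy (se s : EPSState Bus r) : ℝ :=
  ∑ i, eps.mismatch se s i * (eps.M i * s.ω i)

@[fun_prop]
theorem continuous_mismatch (se : EPSState Bus r) {X : Type*} [TopologicalSpace X]
    {f : X → EPSState Bus r} (hf : Continuous f) (i : Bus) :
    Continuous fun x => eps.mismatch se (f x) i := by
  unfold mismatch flowDev; fun_prop

@[fun_prop]
theorem continuous_energy (c : Bus → ℝ) (se : EPSState Bus r) {X : Type*} [TopologicalSpace X]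
    {f : X → EPSState Bus r} (hf : Continuous f) : Continuous fun x => eps.energy c se (f x) := by
  unfold energy lineEnergy; fun_prop

@[fun_prop]
theorem continuous_crossEnergy (se : EPSState Bus r) {X : Type*} [TopologicalSpace X]
    {f : X → EPSState Bus r} (hf : Continuous f) :
    Continuous fun x => eps.crossEnergy se (f x) := by
  unfold crossEnergy; fun_prop

theorem isOpen_secure : IsOpen {s : EPSState Bus r | eps.Secure s} := by
  have : {s : EPSState Bus r | eps.Secure s} =
      ⋂ i, ⋂ j, ⋂ _ : eps.B i j ≠ 0, {s | |s.θ i - s.θ j| < Real.pi / 2} := by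
    ext s
    simp [Secure]
  rw [this]
  refine isOpen_iInter_of_finite fun i => isOpen_iInter_of_finite fun j =>
    isOpen_iInter_of_finite fun _ => isOpen_lt (by fun_prop) continuous_const

variable {eps}

theorem lineEnergy_nonneg {se s : EPSState Bus r} (hse : eps.Secure se) (hs : eps.Secure s) :
    0 ≤ eps.lineEnergy se s :=
  Finset.sum_nonneg fun i _ => Finset.sum_nonneg fun j _ => lineEnergy_term_nonneg hse hs i j

theorem θ_eq_of_lineEnergy_eq_zero (hconn : eps.graph.Connected) {se s : EPSState Bus r}
    (hse : eps.Secure se) (hs : eps.Secure s) (h : eps.lineEnergy se s = 0) (i : Bus) :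
    s.θ i = se.θ i := by
  refine θ_eq_of_lines hconn (fun i j hB => ?_) i
  have := Finset.eq_zero_of_sum_sum_eq_zero (lineEnergy_term_nonneg hse hs) h i j
  by_contra hne
  exact absurd this
    (mul_pos (eps.lineGain_pos hB) (Real.cos_bregman_pos (hse i j hB) (hs i j hB) hne)).ne'

theorem energy_nonneg {c : Bus → ℝ} (hc : ∀ i, 0 < c i) {se s : EPSState Bus r}
    (hse : eps.Secure se) (hs : eps.Secure s) : 0 ≤ eps.energy c se s := by
  have h1 := lineEnergy_nonneg hse hs
  have h2 : 0 ≤ ∑ i, eps.M i * s.ω i ^ 2 / 2 := Finset.sum_nonneg fun i _ => by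
    have := eps.M_pos i
    positivity
  have h3 : 0 ≤ ∑ i, c i * eps.Tg i * eps.govDev s i ^ 2 / 2 := Finset.sum_nonneg fun i _ => by
    have := eps.Tg_pos i
    have := hc i
    positivity
  have h4 := mul_nonneg eps.KI_pos.le (sq_nonneg (s.g - se.g))
  unfold energy
  linarith

/-- Zero energy kills each of its four nonnegative parts. The lines give the angles, and `PG` is
recovered from `govDev` once `g` is known. -/
theorem energy_pos (hconn : eps.graph.Connected) {c : Bus → ℝ} (hc : ∀ i, 0 < c i)
    {se s : EPSState Bus r} (hse : eps.Secure se) (hs : eps.Secure s) (hω : se.ω = 0)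
    (hdev : ∀ i, eps.govDev se i = 0) (hne : s ≠ se) : 0 < eps.energy c se s := by
  refine (energy_nonneg hc hse hs).lt_of_ne fun h0 => hne ?_
  have h1 := lineEnergy_nonneg hse hs
  have h2' : ∀ i ∈ Finset.univ, 0 ≤ eps.M i * s.ω i ^ 2 / 2 := fun i _ => by
    have := eps.M_pos i
    positivity
  have h3' : ∀ i ∈ Finset.univ, 0 ≤ c i * eps.Tg i * eps.govDev s i ^ 2 / 2 := fun i _ => by
    have := eps.Tg_pos i
    have := hc i
    positivity
  have h2 := Finset.sum_nonneg h2'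
  have h3 := Finset.sum_nonneg h3'
  have h4 := mul_nonneg eps.KI_pos.le (sq_nonneg (s.g - se.g))
  unfold energy at h0
  have e1 : eps.lineEnergy se s = 0 := by linarith
  have e2 : ∑ i, eps.M i * s.ω i ^ 2 / 2 = 0 := by linarith
  have e3 : ∑ i, c i * eps.Tg i * eps.govDev s i ^ 2 / 2 = 0 := by linarith
  have e4 : eps.KI * (s.g - se.g) ^ 2 = 0 := by linarith
  have hg : s.g = se.g := by
    rcases mul_eq_zero.1 e4 with h | h
    · exact absurd h eps.KI_pos.ne'
    · exact sub_eq_zero.1 (pow_eq_zero_iff two_ne_zero |>.1 h)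
  refine EPSState.ext_coords (θ_eq_of_lineEnergy_eq_zero hconn hse hs e1) (fun i => ?_)
    (fun i => ?_) hg
  · have := (Finset.sum_eq_zero_iff_of_nonneg h2').1 e2 i (Finset.mem_univ i)
    have hM := (eps.M_pos i).ne'
    have hωi : s.ω i = 0 := by simpa [hM] using this
    rw [hωi, hω]
    rfl
  · have := (Finset.sum_eq_zero_iff_of_nonneg h3').1 e3 i (Finset.mem_univ i)
    have hT := (eps.Tg_pos i).ne'
    have hci := (hc i).ne'
    have hi : eps.govDev s i = 0 := by simpa [hT, hci] using this
    have hi' := hdev i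
    unfold govDev at hi hi'
    rw [hg] at hi
    linarith

/-- The mismatch determines angles and AGC state among the secure states. -/
theorem θ_g_eq_of_mismatch_eq_zero (hconn : eps.graph.Connected) {se s : EPSState Bus r}
    (hse : eps.Secure se) (hs : eps.Secure s) (h : ∀ i, eps.mismatch se s i = 0) :
    (∀ i, s.θ i = se.θ i) ∧ s.g = se.g := by
  have hg : s.g = se.g := by
    -- In the sum over all buses the flows cancel by antisymmetry; only the AGC term remains.
    have h1 : ∑ i, eps.mismatch se s i = 0 := Finset.sum_eq_zero fun i _ => h i
    simp only [mismatch, Finset.sum_sub_distrib] at h1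
    rw [Finset.sum_sum_antisymm (eps.flowDev_antisymm se s),
      eps.sum_agcGain_mul fun _ => s.g - se.g, zero_sub, neg_eq_zero] at h1
    rcases mul_eq_zero.1 h1 with h2 | h2
    · exact absurd h2 eps.KI_pos.ne'
    · exact sub_eq_zero.1 h2
  refine ⟨θ_eq_of_lines hconn ?_, hg⟩
  have hflow : ∀ i, ∑ j, eps.flowDev se s i j = 0 := fun i => by
    have := h i
    rwa [mismatch, hg, sub_self, mul_zero, sub_zero] at this
  -- The flow balance is tested against the angle deviations: by monotonicity of the sine, every
  -- line contributes a nonnegative term to a vanishing sum.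
  have hsum := Finset.sum_sum_antisymm_mul_sub (eps.flowDev_antisymm se s)
    fun i => s.θ i - se.θ i
  simp only [hflow, mul_zero, Finset.sum_const_zero] at hsum
  have hrw : ∀ i j, eps.flowDev se s i j * (s.θ i - se.θ i - (s.θ j - se.θ j)) =
      eps.lineGain i j * ((Real.sin (s.θ i - s.θ j) - Real.sin (se.θ i - se.θ j)) *
        ((s.θ i - s.θ j) - (se.θ i - se.θ j))) := fun i j => by
    rw [flowDev]
    ring
  simp only [hrw] at hsum
  intro i j hB
  have := Finset.eq_zero_of_sum_sum_eq_zero (fun i j => ?_) hsum i j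
  · by_contra hne
    exact absurd this
      (mul_pos (eps.lineGain_pos hB) (Real.sin_sub_sin_mul_pos (hse i j hB) (hs i j hB) hne)).ne'
  · by_cases hB : eps.B i j = 0
    · rw [eps.lineGain_eq_zero hB, zero_mul]
    · exact mul_nonneg (eps.lineGain_nonneg i j)
        (Real.sin_sub_sin_mul_nonneg (hse i j hB) (hs i j hB))

end EPS

end

/-! ### Derivatives along trajectories of the power system -/

noncomputable section

theorem HasDerivWithinAt.fst_of_prod {E F : Type*} [NormedAddCommGroup E] [NormedSpace ℝ E]
    [NormedAddCommGroup F] [NormedSpace ℝ F] {x : ℝ → E × F} {v : E × F} {S : Set ℝ} {t : ℝ}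
    (h : HasDerivWithinAt x v S t) : HasDerivWithinAt (fun τ => (x τ).1) v.1 S t :=
  (ContinuousLinearMap.fst ℝ E F).hasFDerivAt.comp_hasDerivWithinAt t h

theorem HasDerivWithinAt.snd_of_prod {E F : Type*} [NormedAddCommGroup E] [NormedSpace ℝ E]
    [NormedAddCommGroup F] [NormedSpace ℝ F] {x : ℝ → E × F} {v : E × F} {S : Set ℝ} {t : ℝ}
    (h : HasDerivWithinAt x v S t) : HasDerivWithinAt (fun τ => (x τ).2) v.2 S t :=
  (ContinuousLinearMap.snd ℝ E F).hasFDerivAt.comp_hasDerivWithinAt t h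

namespace EPS

open Matrix

variable {Bus HP : Type*} {r : Bus} [DecidableEq Bus] [Fintype Bus] [Fintype HP]
  {eps : EPS Bus HP r} {PL : Bus → ℝ}

theorem sum_hpPower_mul (p : HP → ℝ) (w : Bus → ℝ) :
    ∑ i, eps.hpPower p i * w i = p ⬝ᵥ fun k => w (eps.hpBus k) := by
  simp only [hpPower, Finset.sum_mul, dotProduct]
  rw [Finset.sum_comm]
  simp [ite_mul]

/-- Injectivity of `hpBus` enters here: no two heat pumps add up at one bus. -/
theorem sum_hpPower_sq (p : HP → ℝ) : ∑ i, eps.hpPower p i ^ 2 = p ⬝ᵥ p := by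
  have h : ∀ k, eps.hpPower p (eps.hpBus k) = p k := fun k => by
    classical
    simp [hpPower]
  simp only [pow_two]
  rw [sum_hpPower_mul]
  simp only [h]

/-- The equation for `g` gives `ω r = 0`, and the angle equations carry this to every bus. -/
theorem field_eq_zero_iff {s : EPSState Bus r} {p : HP → ℝ} :
    eps.field PL s p = 0 ↔ s.ω = 0 ∧ (∀ i, eps.govDev s i = 0) ∧
      ∀ i, eps.netPower PL s i = s.PG i - eps.hpPower p i := by
  have hgov : s.ω = 0 → ∀ i, eps.control s i = eps.agcGain i * s.g := fun h i => by
    simp [control, agcGain, h]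
  constructor
  · intro h
    have hr : s.ω r = 0 := by
      have := congrArg EPSState.g h
      exact neg_eq_zero.1 this
    have hω : s.ω = 0 := by
      funext i
      by_cases hi : i = r
      · rw [hi, hr]; rfl
      · have : s.ω i - s.ω r = 0 := congrFun (congrArg EPSState.xθ h) ⟨i, hi⟩
        rw [hr, sub_zero] at this
        exact this
    refine ⟨hω, fun i => ?_, fun i => ?_⟩
    · have : (-s.PG i + eps.control s i) / eps.Tg i = 0 := congrFun (congrArg EPSState.PG h) i
      rw [div_eq_zero_iff, or_iff_left (eps.Tg_pos i).ne', hgov hω] at this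
      rw [govDev]
      linarith
    · have : (-eps.D i * s.ω i - eps.netPower PL s i + s.PG i - eps.hpPower p i) / eps.M i = 0 :=
        congrFun (congrArg EPSState.ω h) i
      rw [div_eq_zero_iff, or_iff_left (eps.M_pos i).ne', hω] at this
      simp only [Pi.zero_apply, mul_zero] at this
      linarith
  · rintro ⟨hω, hz, hP⟩
    refine Prod.ext (funext fun i => ?_) (Prod.ext (funext fun i => ?_)
      (Prod.ext (funext fun i => ?_) ?_))
    · change s.ω i - s.ω r = 0
      simp [hω]
    · change (-eps.D i * s.ω i - eps.netPower PL s i + s.PG i - eps.hpPower p i) / eps.M i = 0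
      rw [hP i, hω]
      simp
    · change (-s.PG i + eps.control s i) / eps.Tg i = 0
      have := hz i
      rw [govDev] at this
      rw [hgov hω, div_eq_zero_iff]
      left
      linarith
    · change -s.ω r = 0
      simp [hω]

/-- Subtracting the balance at `se` removes `PL` and splits the accelerating power into `mismatch`,
a function of angles and `g` alone, and the fast mode. -/
theorem netPower_sub_PG {se : EPSState Bus r} (hse : eps.field PL se 0 = 0) (s : EPSState Bus r)
    (i : Bus) : eps.netPower PL s i - s.PG i = eps.mismatch se s i - eps.govDev s i := by
  obtain ⟨-, hz, hP⟩ := field_eq_zero_iff.1 hse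
  have h1 := hP i
  have h2 := hz i
  have h3 : eps.hpPower (0 : HP → ℝ) i = 0 := by simp [hpPower]
  have h4 : ∑ j, eps.flowDev se s i j = eps.netPower PL s i - eps.netPower PL se i := by
    simp only [flowDev, netPower, mul_sub, Finset.sum_sub_distrib, lineGain]
    ring
  rw [mismatch, govDev, h4, h1, h3]
  rw [govDev] at h2
  linarith

section Curve

variable {s : ℝ → EPSState Bus r} {p : HP → ℝ} {S : Set ℝ} {t : ℝ}

theorem hasDerivWithinAt_θ (h : HasDerivWithinAt s (eps.field PL (s t) p) S t) (i : Bus) :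
    HasDerivWithinAt (fun τ => (s τ).θ i) ((s t).ω i - (s t).ω r) S t := by
  by_cases hi : i = r
  · subst hi
    simpa [EPSState.θ_ref] using hasDerivWithinAt_const t S (0 : ℝ)
  · have := hasDerivWithinAt_pi.1 h.fst_of_prod ⟨i, hi⟩
    simp only [EPSState.θ, dif_pos hi]
    exact this

theorem hasDerivWithinAt_ω {se : EPSState Bus r} (hse : eps.field PL se 0 = 0)
    (h : HasDerivWithinAt s (eps.field PL (s t) p) S t) (i : Bus) :
    HasDerivWithinAt (fun τ => (s τ).ω i)
      ((-eps.D i * (s t).ω i - eps.mismatch se (s t) i + eps.govDev (s t) i - eps.hpPower p i) /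
        eps.M i) S t := by
  have := hasDerivWithinAt_pi.1 h.snd_of_prod.fst_of_prod i
  have e := netPower_sub_PG hse (s t) i
  convert! this using 1
  change _ = (-eps.D i * (s t).ω i - eps.netPower PL (s t) i + (s t).PG i - eps.hpPower p i) /
    eps.M i
  congr 1
  linarith

theorem hasDerivWithinAt_g (h : HasDerivWithinAt s (eps.field PL (s t) p) S t) :
    HasDerivWithinAt (fun τ => (s τ).g) (-(s t).ω r) S t :=
  h.snd_of_prod.snd_of_prod.snd_of_prod

/-- Subtracting the AGC signal from `PG` eliminates `g` from the governor equation; the motion of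
`g` turns the gain `KP` into `fastGain`. -/
theorem hasDerivWithinAt_govDev (h : HasDerivWithinAt s (eps.field PL (s t) p) S t) (i : Bus) :
    HasDerivWithinAt (fun τ => eps.govDev (s τ) i)
      ((-eps.govDev (s t) i - eps.fastGain i * (s t).ω i) / eps.Tg i) S t := by
  have h1 : HasDerivWithinAt (fun τ => (s τ).PG i)
      ((-(s t).PG i + eps.control (s t) i) / eps.Tg i) S t :=
    hasDerivWithinAt_pi.1 h.snd_of_prod.snd_of_prod.fst_of_prod i
  convert! h1.sub ((hasDerivWithinAt_g h).const_mul (eps.agcGain i)) using 1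
  have hT := (eps.Tg_pos i).ne'
  rw [govDev, fastGain, control, agcGain]
  split_ifs with hi
  · subst hi
    field_simp
    ring
  · field_simp
    ring

theorem hasDerivWithinAt_angleDiff (h : HasDerivWithinAt s (eps.field PL (s t) p) S t)
    (i j : Bus) : HasDerivWithinAt (fun τ => (s τ).θ i - (s τ).θ j)
      ((s t).ω i - (s t).ω j) S t := by
  convert! (hasDerivWithinAt_θ h i).sub (hasDerivWithinAt_θ h j) using 1
  ring

theorem hasDerivWithinAt_mismatch (se : EPSState Bus r)
    (h : HasDerivWithinAt s (eps.field PL (s t) p) S t) (i : Bus) :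
    HasDerivWithinAt (fun τ => eps.mismatch se (s τ) i)
      (∑ j, eps.lineGain i j * (Real.cos ((s t).θ i - (s t).θ j) * ((s t).ω i - (s t).ω j)) +
        eps.agcGain i * (s t).ω r) S t := by
  have h1 := HasDerivWithinAt.fun_sum (u := Finset.univ) fun j _ =>
    ((hasDerivWithinAt_angleDiff h i j).sin.sub_const
      (Real.sin (se.θ i - se.θ j))).const_mul (eps.lineGain i j)
  convert! h1.sub (((hasDerivWithinAt_g h).sub_const se.g).const_mul (eps.agcGain i)) using 1
  ring

/-- The factor `2` comes from counting each line in both orientations, which is why `energy`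
contains half of `lineEnergy`. -/
theorem hasDerivWithinAt_lineEnergy (se : EPSState Bus r)
    (h : HasDerivWithinAt s (eps.field PL (s t) p) S t) :
    HasDerivWithinAt (fun τ => eps.lineEnergy se (s τ))
      (2 * ∑ i, (s t).ω i * ∑ j, eps.flowDev se (s t) i j) S t := by
  rw [← Finset.sum_sum_antisymm_mul_sub (eps.flowDev_antisymm se (s t))]
  refine HasDerivWithinAt.fun_sum fun i _ => HasDerivWithinAt.fun_sum fun j _ => ?_
  have hd := hasDerivWithinAt_angleDiff h i j
  convert! ((hd.cos.const_sub (Real.cos (se.θ i - se.θ j))).sub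
    ((hd.sub_const (se.θ i - se.θ j)).const_mul (Real.sin (se.θ i - se.θ j)))).const_mul
    (eps.lineGain i j) using 1
  rw [flowDev]
  ring

/-- The mismatch power in the kinetic term is cancelled by the line energy and the AGC storage. What
survives is local to each bus, apart from the power exchanged with the heat pumps. -/
theorem hasDerivWithinAt_energy (c : Bus → ℝ) {se : EPSState Bus r}
    (hse : eps.field PL se 0 = 0) (h : HasDerivWithinAt s (eps.field PL (s t) p) S t) :
    HasDerivWithinAt (fun τ => eps.energy c se (s τ))
      (∑ i, (-eps.D i * (s t).ω i ^ 2 + eps.govDev (s t) i * (s t).ω i -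
        c i * eps.govDev (s t) i ^ 2 -
        c i * eps.fastGain i * (eps.govDev (s t) i * (s t).ω i)) - p ⬝ᵥ eps.ωHP (s t)) S t := by
  have h1 := HasDerivWithinAt.fun_sum (u := Finset.univ) fun i _ =>
    (((hasDerivWithinAt_ω hse h i).pow 2).const_mul (eps.M i)).div_const 2
  have h2 := (hasDerivWithinAt_lineEnergy se h).div_const 2
  have h3 := ((((hasDerivWithinAt_g h).sub_const se.g).pow 2).const_mul eps.KI).div_const 2
  have h4 := HasDerivWithinAt.fun_sum (u := Finset.univ) fun i _ =>
    (((hasDerivWithinAt_govDev h i).pow 2).const_mul (c i * eps.Tg i)).div_const 2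
  convert! ((h1.add h2).add h3).add h4 using 1
  have e1 : p ⬝ᵥ eps.ωHP (s t) = ∑ i, eps.hpPower p i * (s t).ω i := by
    rw [sum_hpPower_mul]; rfl
  have e2 : eps.KI * (((s t).g - se.g) * (s t).ω r) =
      ∑ i, eps.agcGain i * (((s t).g - se.g) * (s t).ω i) :=
    (eps.sum_agcGain_mul fun i => ((s t).g - se.g) * (s t).ω i).symm
  have e3 : eps.KI * ((2 : ℕ) * ((s t).g - se.g) ^ (2 - 1) * -(s t).ω r) / 2 =
      -(eps.KI * (((s t).g - se.g) * (s t).ω r)) := by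
    push_cast; ring
  rw [e3, e2, e1, mul_div_cancel_left₀ _ (two_ne_zero' ℝ), ← Finset.sum_neg_distrib,
    ← Finset.sum_sub_distrib, ← Finset.sum_add_distrib, ← Finset.sum_add_distrib,
    ← Finset.sum_add_distrib]
  refine Finset.sum_congr rfl fun i _ => ?_
  have hM := (eps.M_pos i).ne'
  have hT := (eps.Tg_pos i).ne'
  rw [mismatch]
  field_simp
  push_cast
  ring

theorem hasDerivWithinAt_crossEnergy {se : EPSState Bus r}
    (hse : eps.field PL se 0 = 0) (h : HasDerivWithinAt s (eps.field PL (s t) p) S t) :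
    HasDerivWithinAt (fun τ => eps.crossEnergy se (s τ))
      (∑ i, ((∑ j, eps.lineGain i j *
          (Real.cos ((s t).θ i - (s t).θ j) * ((s t).ω i - (s t).ω j)) +
            eps.agcGain i * (s t).ω r) * (eps.M i * (s t).ω i) +
        eps.mismatch se (s t) i * (-eps.D i * (s t).ω i - eps.mismatch se (s t) i +
          eps.govDev (s t) i - eps.hpPower p i))) S t := by
  refine HasDerivWithinAt.fun_sum fun i _ => ?_
  have hM := (eps.M_pos i).ne'
  convert! (hasDerivWithinAt_mismatch se h i).mul
    ((hasDerivWithinAt_ω hse h i).const_mul (eps.M i)) using 1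
  field_simp

end Curve

variable (eps)

/-- The cross term decreases at the rate of the squared mismatch, up to terms which are controlled
by frequencies, generation deviations and heat-pump power. -/
theorem exists_crossEnergy_deriv_le (se : EPSState Bus r) :
    ∃ C : ℝ, 0 ≤ C ∧ ∀ (s : EPSState Bus r) (p : HP → ℝ),
      ∑ i, ((∑ j, eps.lineGain i j *
          (Real.cos (s.θ i - s.θ j) * (s.ω i - s.ω j)) +
            eps.agcGain i * s.ω r) * (eps.M i * s.ω i) +
        eps.mismatch se s i * (-eps.D i * s.ω i - eps.mismatch se s i +
          eps.govDev s i - eps.hpPower p i)) ≤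
      -(1 / 4 * ∑ i, eps.mismatch se s i ^ 2) +
        C * (∑ i, (s.ω i ^ 2 + eps.govDev s i ^ 2) + p ⬝ᵥ p) := by
  have hagc : ∀ i, 0 ≤ eps.agcGain i := fun i => by
    have := eps.KI_pos.le
    rw [agcGain]; split_ifs <;> simp [this]
  have hM : ∀ i, 0 ≤ eps.M i := fun i => (eps.M_pos i).le
  set C₁ := ∑ i, (∑ j, eps.lineGain i j * 2 + eps.agcGain i) * eps.M i with hC₁
  have hC₁0 : 0 ≤ C₁ := Finset.sum_nonneg fun i _ => mul_nonneg (add_nonneg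
    (Finset.sum_nonneg fun j _ => mul_nonneg (eps.lineGain_nonneg i j) zero_le_two) (hagc i)) (hM i)
  set C₂ := ∑ i, eps.D i ^ 2 with hC₂
  have hC₂0 : 0 ≤ C₂ := Finset.sum_nonneg fun i _ => sq_nonneg _
  refine ⟨C₁ + C₂ + 1, by linarith, fun s p => ?_⟩
  set W := ∑ i, s.ω i ^ 2 with hW
  have hW0 : 0 ≤ W := Finset.sum_nonneg fun i _ => sq_nonneg _
  have hωW : ∀ i, s.ω i ^ 2 ≤ W := fun i =>
    Finset.single_le_sum (f := fun i => s.ω i ^ 2) (fun i _ => sq_nonneg _) (Finset.mem_univ i)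
  have hprod : ∀ i j, |s.ω i * s.ω j| ≤ W := fun i j => by
    rw [abs_le]
    constructor <;> nlinarith [hωW i, hωW j, sq_nonneg (s.ω i + s.ω j), sq_nonneg (s.ω i - s.ω j)]
  have hcross : ∀ i, (∑ j, eps.lineGain i j * (Real.cos (s.θ i - s.θ j) * (s.ω i - s.ω j)) +
      eps.agcGain i * s.ω r) * (eps.M i * s.ω i) ≤
      (∑ j, eps.lineGain i j * 2 + eps.agcGain i) * eps.M i * W := fun i => by
    have h1 : ∑ j, eps.lineGain i j * (Real.cos (s.θ i - s.θ j) * (s.ω i - s.ω j)) * s.ω i ≤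
        ∑ j, eps.lineGain i j * 2 * W := by
      refine Finset.sum_le_sum fun j _ => ?_
      have h2 : Real.cos (s.θ i - s.θ j) * ((s.ω i - s.ω j) * s.ω i) ≤ 2 * W := by
        calc Real.cos (s.θ i - s.θ j) * ((s.ω i - s.ω j) * s.ω i)
            ≤ |Real.cos (s.θ i - s.θ j)| * |(s.ω i - s.ω j) * s.ω i| := by
              rw [← abs_mul]; exact le_abs_self _
          _ ≤ 1 * |(s.ω i - s.ω j) * s.ω i| := by
              gcongr
              exact Real.abs_cos_le_one _
          _ ≤ 2 * W := by
              have h3 := hprod i i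
              have h4 := hprod j i
              rw [one_mul, sub_mul]
              calc _ ≤ |s.ω i * s.ω i| + |s.ω j * s.ω i| := abs_sub _ _
                _ ≤ _ := by linarith
      calc _ = eps.lineGain i j * (Real.cos (s.θ i - s.θ j) * ((s.ω i - s.ω j) * s.ω i)) := by ring
        _ ≤ eps.lineGain i j * (2 * W) := mul_le_mul_of_nonneg_left h2 (eps.lineGain_nonneg i j)
        _ = _ := by ring
    have h5 : eps.agcGain i * (s.ω r * s.ω i) ≤ eps.agcGain i * W :=
      mul_le_mul_of_nonneg_left ((le_abs_self _).trans (hprod r i)) (hagc i)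
    rw [← Finset.sum_mul, ← Finset.sum_mul] at h1
    calc _ = ((∑ j, eps.lineGain i j * (Real.cos (s.θ i - s.θ j) * (s.ω i - s.ω j))) * s.ω i +
          eps.agcGain i * (s.ω r * s.ω i)) * eps.M i := by ring
      _ ≤ ((∑ j, eps.lineGain i j * 2) * W + eps.agcGain i * W) * eps.M i :=
          mul_le_mul_of_nonneg_right (add_le_add h1 h5) (hM i)
      _ = _ := by ring
  have hmis : ∀ i, eps.mismatch se s i * (-eps.D i * s.ω i - eps.mismatch se s i +
      eps.govDev s i - eps.hpPower p i) ≤ -(1 / 4 * eps.mismatch se s i ^ 2) +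
      (eps.D i ^ 2 * W + eps.govDev s i ^ 2 + eps.hpPower p i ^ 2) := fun i => by
    have h1 : eps.D i ^ 2 * s.ω i ^ 2 ≤ eps.D i ^ 2 * W :=
      mul_le_mul_of_nonneg_left (hωW i) (sq_nonneg _)
    -- Three Young inequalities use a quarter of the squared mismatch each; the last quarter is the
    -- decay.
    nlinarith [sq_nonneg (eps.mismatch se s i / 2 + eps.D i * s.ω i),
      sq_nonneg (eps.mismatch se s i / 2 - eps.govDev s i),
      sq_nonneg (eps.mismatch se s i / 2 + eps.hpPower p i)]
  refine (Finset.sum_le_sum fun i _ => add_le_add (hcross i) (hmis i)).trans ?_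
  simp only [Finset.sum_add_distrib, ← Finset.sum_mul, Finset.sum_neg_distrib, ← Finset.mul_sum,
    sum_hpPower_sq]
  simp only [← Finset.sum_mul] at hC₁
  rw [← hC₁, ← hC₂, ← hW]
  have hZ : 0 ≤ ∑ i, eps.govDev s i ^ 2 := Finset.sum_nonneg fun i _ => sq_nonneg _
  have hp := dotProduct_self_nonneg_real p
  have hC : 0 ≤ C₁ + C₂ := by linarith
  nlinarith [mul_nonneg hC hZ, mul_nonneg hC hp]

end EPS

end

/-! ### Regularity of the coupled field -/

noncomputable section

section Regularity

variable {E F F' ι : Type*} [NormedAddCommGroup E] [NormedSpace ℝ E]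
  [NormedAddCommGroup F] [NormedSpace ℝ F] [NormedAddCommGroup F'] [NormedSpace ℝ F'] [Fintype ι]

/-- `C¹` and globally Lipschitz. -/
def LipschitzC1 (f : E → F) : Prop := ContDiff ℝ 1 f ∧ ∃ K, LipschitzWith K f

namespace LipschitzC1

theorem id : LipschitzC1 fun x : E => x := ⟨contDiff_id, _, LipschitzWith.id⟩

theorem const (y : F) : LipschitzC1 fun _ : E => y := ⟨contDiff_const, _, LipschitzWith.const y⟩

theorem clm_comp (L : F →L[ℝ] F') {f : E → F} (hf : LipschitzC1 f) :
    LipschitzC1 fun x => L (f x) :=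
  ⟨L.contDiff.comp hf.1, let ⟨_, hK⟩ := hf.2; ⟨_, L.lipschitz.comp hK⟩⟩

theorem fst {f : E → F × F'} (hf : LipschitzC1 f) : LipschitzC1 fun x => (f x).1 :=
  hf.clm_comp (ContinuousLinearMap.fst ℝ F F')

theorem snd {f : E → F × F'} (hf : LipschitzC1 f) : LipschitzC1 fun x => (f x).2 :=
  hf.clm_comp (ContinuousLinearMap.snd ℝ F F')

theorem apply {f : E → ι → ℝ} (hf : LipschitzC1 f) (i : ι) : LipschitzC1 fun x => f x i :=
  hf.clm_comp (ContinuousLinearMap.proj (R := ℝ) (φ := fun _ : ι => ℝ) i)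

theorem mulVec {κ : Type*} [Fintype κ] (M : Matrix κ ι ℝ) {f : E → ι → ℝ} (hf : LipschitzC1 f) :
    LipschitzC1 fun x => M.mulVec (f x) :=
  ⟨M.contDiff_mulVec.comp hf.1,
    let ⟨_, hM⟩ := M.exists_lipschitzWith_mulVec; let ⟨_, hK⟩ := hf.2; ⟨_, hM.comp hK⟩⟩

theorem prodMk {f : E → F} {g : E → F'} (hf : LipschitzC1 f) (hg : LipschitzC1 g) :
    LipschitzC1 fun x => (f x, g x) :=
  ⟨hf.1.prodMk hg.1, let ⟨_, hK⟩ := hf.2; let ⟨_, hK'⟩ := hg.2; ⟨_, hK.prodMk hK'⟩⟩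

theorem pi {f : E → ι → ℝ} (hf : ∀ i, LipschitzC1 fun x => f x i) : LipschitzC1 f := by
  refine ⟨contDiff_pi.2 fun i => (hf i).1, ?_⟩
  choose K hK using fun i => (hf i).2
  refine ⟨∑ i, K i, LipschitzWith.of_dist_le_mul fun x y => ?_⟩
  refine (dist_pi_le_iff (by positivity)).2 fun i => ((hK i).dist_le_mul x y).trans ?_
  gcongr
  exact Finset.single_le_sum (f := K) (fun _ _ => zero_le) (Finset.mem_univ i)

theorem add {f g : E → F} (hf : LipschitzC1 f) (hg : LipschitzC1 g) :
    LipschitzC1 fun x => f x + g x :=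
  ⟨hf.1.add hg.1, let ⟨_, hK⟩ := hf.2; let ⟨_, hK'⟩ := hg.2; ⟨_, hK.add hK'⟩⟩

theorem neg {f : E → F} (hf : LipschitzC1 f) : LipschitzC1 fun x => -f x :=
  ⟨hf.1.neg, let ⟨_, hK⟩ := hf.2; ⟨_, hK.neg⟩⟩

theorem sub {f g : E → F} (hf : LipschitzC1 f) (hg : LipschitzC1 g) :
    LipschitzC1 fun x => f x - g x :=
  ⟨hf.1.sub hg.1, let ⟨_, hK⟩ := hf.2; let ⟨_, hK'⟩ := hg.2; ⟨_, hK.sub hK'⟩⟩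

theorem const_mul (c : ℝ) {f : E → ℝ} (hf : LipschitzC1 f) : LipschitzC1 fun x => c * f x :=
  hf.clm_comp (c • ContinuousLinearMap.id ℝ ℝ)

theorem div_const {f : E → ℝ} (hf : LipschitzC1 f) (c : ℝ) : LipschitzC1 fun x => f x / c := by
  simpa only [div_eq_inv_mul] using hf.const_mul c⁻¹

theorem sum {κ : Type*} (s : Finset κ) {f : κ → E → ℝ} (hf : ∀ k, LipschitzC1 (f k)) :
    LipschitzC1 fun x => ∑ k ∈ s, f k x := by
  classical
  induction s using Finset.induction_on with
  | empty => simpa using const (0 : ℝ)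
  | insert a s ha ih => simpa only [Finset.sum_insert ha] using (hf a).add ih

theorem sin {f : E → ℝ} (hf : LipschitzC1 f) : LipschitzC1 fun x => Real.sin (f x) :=
  ⟨hf.1.sin, let ⟨_, hK⟩ := hf.2; ⟨_, Real.lipschitzWith_sin.comp hK⟩⟩

end LipschitzC1

end Regularity

section FieldRegularity

variable {E Bus HP L N : Type*} {r : Bus} {m : ℕ} [NormedAddCommGroup E] [NormedSpace ℝ E]
  [Fintype Bus] [Fintype HP] [DecidableEq Bus]

theorem EPSState.lipschitzC1_ω {f : E → EPSState Bus r} (hf : LipschitzC1 f) (i : Bus) :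
    LipschitzC1 fun x => (f x).ω i := hf.snd.fst.apply i

theorem EPSState.lipschitzC1_θ {f : E → EPSState Bus r} (hf : LipschitzC1 f) (i : Bus) :
    LipschitzC1 fun x => (f x).θ i := by
  unfold θ
  split_ifs with h
  · exact hf.fst.apply ⟨i, h⟩
  · exact LipschitzC1.const 0

theorem EPS.lipschitzC1_field (eps : EPS Bus HP r) (PL : Bus → ℝ) {f : E → EPSState Bus r}
    (hf : LipschitzC1 f) {p : E → HP → ℝ} (hp : LipschitzC1 p) :
    LipschitzC1 fun x => eps.field PL (f x) (p x) := by
  have hω := EPSState.lipschitzC1_ω hf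
  have hθ := EPSState.lipschitzC1_θ hf
  have hPG : ∀ i, LipschitzC1 fun x => (f x).PG i := fun i => hf.snd.snd.fst.apply i
  have hg : LipschitzC1 fun x => (f x).g := hf.snd.snd.snd
  refine LipschitzC1.prodMk (LipschitzC1.pi fun i => (hω i).sub (hω r))
    (LipschitzC1.prodMk (LipschitzC1.pi fun i => ?_)
      (LipschitzC1.prodMk (LipschitzC1.pi fun i => ?_) (hω r).neg))
  · refine LipschitzC1.div_const ?_ _
    refine ((((hω i).const_mul _).sub ?_).add (hPG i)).sub ?_
    · exact (LipschitzC1.sum _ fun j => (((hθ i).sub (hθ j)).sin.const_mul _)).sub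
        (LipschitzC1.const _)
    · refine LipschitzC1.sum _ fun k => ?_
      split_ifs
      · exact hp.apply k
      · exact LipschitzC1.const 0
  · refine ((hPG i).neg.add (((hω i).const_mul _).add ?_)).div_const _
    split_ifs
    · exact hg.const_mul _
    · exact LipschitzC1.const 0

/-- The only nonlinearity is the sine of angle differences, so solutions are global. -/
theorem lipschitzC1_chpField [Fintype L] [Fintype N] [DecidableEq HP] [DecidableEq L]
    [DecidableEq N] (eps : EPS Bus HP r) (dhs : DHS m HP L N)
    (KT : Matrix (Fin (m + 1)) (TempIdx m HP L N) ℝ)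
    (KI : Matrix (Fin (m + 1)) (ErrIdx m) ℝ) (PL : Bus → ℝ) (hL : L → ℝ) :
    LipschitzC1 (chpField eps dhs KT KI PL hL) := by
  have hu : LipschitzC1 fun s : EPSState Bus r × DHSState m HP L N => eps.ωHP s.1 :=
    LipschitzC1.pi fun k => EPSState.lipschitzC1_ω LipschitzC1.id.fst _
  exact (eps.lipschitzC1_field PL LipschitzC1.id.fst
    ((hu.mulVec _).add (LipschitzC1.id.snd.mulVec _))).prodMk
    (((LipschitzC1.id.snd.mulVec _).add (hu.mulVec _)).add (LipschitzC1.const _))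

end FieldRegularity

/-! ### Rest points of the regulated heating system -/

namespace DHS

open Matrix

variable {HP L N : Type*} {m : ℕ} [Fintype HP] [Fintype L] [Fintype N]
  [DecidableEq HP] [DecidableEq L] [DecidableEq N] (dhs : DHS m HP L N)
  (KT : Matrix (Fin (m + 1)) (TempIdx m HP L N) ℝ) (KI : Matrix (Fin (m + 1)) (ErrIdx m) ℝ)
  (hL : L → ℝ)

/-- The integrator states integrate the error. -/
theorem field_inr (x : DHSState m HP L N) (u : HP → ℝ) (j : ErrIdx m) :
    dhs.field KT KI hL x u (Sum.inr j) = dhs.err KT KI x j := by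
  have h1 : x = Sum.elim (x ∘ Sum.inl) (x ∘ Sum.inr) := (Sum.elim_comp_inl_inr x).symm
  have h2 : (fun i => x (Sum.inl i)) = x ∘ Sum.inl := rfl
  rw [field, err, hG, Acl, Bclω, Bclh, fromRows_mulVec, fromRows_mulVec, h2]
  nth_rw 1 [h1]
  nth_rw 4 [h1]
  rw [fromBlocks_mulVec, fromCols_mulVec_sumElim]
  simp only [Pi.add_apply, Sum.elim_inr, zero_mulVec, Pi.zero_apply, add_zero, mulVec_neg,
    mulVec_add, sub_mulVec, neg_mulVec, mulVec_mulVec, Pi.neg_apply, Pi.sub_apply,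
    Function.comp_def, Sum.elim_inl]
  ring

theorem field_sub {xs : DHSState m HP L N} (hxs : dhs.field KT KI hL xs 0 = 0)
    (x : DHSState m HP L N) (u : HP → ℝ) :
    dhs.field KT KI hL x u = dhs.Acl KT KI *ᵥ (x - xs) + dhs.Bclω *ᵥ u := by
  have h : dhs.field KT KI hL x u = dhs.field KT KI hL x u - dhs.field KT KI hL xs 0 := by
    rw [hxs, sub_zero]
  rw [h, field, field, mulVec_sub, mulVec_zero]
  abel

theorem exists_field_eq_zero (hA : IsUnit (dhs.Acl KT KI)) :
    ∃ xs, dhs.field KT KI hL xs 0 = 0 := by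
  refine ⟨(dhs.Acl KT KI)⁻¹ *ᵥ (-(dhs.Bclh *ᵥ dhs.wh hL)), ?_⟩
  rw [field, mulVec_mulVec, mul_nonsing_inv _ ((isUnit_iff_isUnit_det _).1 hA), one_mulVec,
    mulVec_zero]
  abel

theorem eq_of_field_eq_zero (hA : IsUnit (dhs.Acl KT KI)) {xs x : DHSState m HP L N}
    (hxs : dhs.field KT KI hL xs 0 = 0) (hx : dhs.field KT KI hL x 0 = 0) : x = xs := by
  rw [dhs.field_sub KT KI hL hxs, mulVec_zero, add_zero] at hx
  exact sub_eq_zero.1 (mulVec_injective_of_isUnit hA (by rw [hx, mulVec_zero]))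

end DHS

end

/-! ### Equilibrium and stability of the interconnection -/

section Interconnection

open Matrix

variable {Bus HP L N : Type*} {r : Bus} {m : ℕ}

theorem EPS.ωHP_dotProduct_self_le [Fintype Bus] [Fintype HP] (eps : EPS Bus HP r) (s : EPSState Bus r) :
    eps.ωHP s ⬝ᵥ eps.ωHP s ≤ ∑ i, s.ω i ^ 2 := by
  have h1 : eps.ωHP s ⬝ᵥ eps.ωHP s = ∑ i ∈ Finset.univ.map eps.hpBus, s.ω i ^ 2 := by
    simp [dotProduct, ωHP, pow_two]
  rw [h1]
  exact Finset.sum_le_sum_of_subset_of_nonneg (Finset.subset_univ _) fun i _ _ => sq_nonneg _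

theorem EPS.ωHP_eq_zero (eps : EPS Bus HP r) {s : EPSState Bus r} (hs : s.ω = 0) :
    eps.ωHP s = 0 := by
  funext k
  simp [ωHP, hs]

/-- A passive storage function forces the output to vanish at an equilibrium for zero input. -/
theorem output_eq_zero_of_passive {X ι : Type*} [NormedAddCommGroup X] [NormedSpace ℝ X]
    [Fintype ι] {f : X → (ι → ℝ) → X} {h : X → (ι → ℝ) → (ι → ℝ)} {V : X → ℝ} {ρ : ℝ} (hρ : 0 < ρ)
    (hV : ∀ x u, fderiv ℝ V x (f x u) ≤ h x u ⬝ᵥ u - ρ * (h x u ⬝ᵥ h x u)) {xs : X}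
    (hxs : f xs 0 = 0) : h xs 0 = 0 := by
  have h1 := hV xs 0
  rw [hxs, map_zero, dotProduct_zero, zero_sub] at h1
  by_contra hne
  have := mul_pos hρ (dotProduct_self_pos_real hne)
  linarith

variable [Fintype Bus] [Fintype HP] [Fintype L] [Fintype N]
  [DecidableEq Bus] [DecidableEq HP] [DecidableEq L] [DecidableEq N]
  {eps : EPS Bus HP r} {dhs : DHS m HP L N}
  {KT : Matrix (Fin (m + 1)) (TempIdx m HP L N) ℝ} {KI : Matrix (Fin (m + 1)) (ErrIdx m) ℝ}
  {PL : Bus → ℝ} {hL : L → ℝ}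

theorem chpField_eq_zero_unique (hconn : eps.graph.Connected) (hA : IsUnit (dhs.Acl KT KI))
    {se s : EPSState Bus r} {xs x : DHSState m HP L N} (hse : eps.field PL se (0 : HP → ℝ) = 0)
    (hsec : eps.Secure se) (hxs : dhs.field KT KI hL xs 0 = 0) (hout : dhs.pH KT KI xs 0 = 0)
    (h : chpField eps dhs KT KI PL hL (s, x) = 0) (hs : eps.Secure s) : (s, x) = (se, xs) := by
  have h1 : eps.field PL s (dhs.pH KT KI x (eps.ωHP s)) = 0 := congrArg Prod.fst h
  have h2 : dhs.field KT KI hL x (eps.ωHP s) = 0 := congrArg Prod.snd h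
  have hω := (EPS.field_eq_zero_iff.1 h1).1
  rw [eps.ωHP_eq_zero hω] at h1 h2
  have hx := dhs.eq_of_field_eq_zero KT KI hL hA hxs h2
  subst hx
  rw [hout] at h1
  obtain ⟨-, hz, hP⟩ := EPS.field_eq_zero_iff.1 h1
  obtain ⟨hωe, hze, -⟩ := EPS.field_eq_zero_iff.1 hse
  have hmis : ∀ i, eps.mismatch se s i = 0 := fun i => by
    have e1 := EPS.netPower_sub_PG hse s i
    have e2 : eps.hpPower (0 : HP → ℝ) i = 0 := by simp [EPS.hpPower]
    rw [hP i, e2, hz i] at e1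
    linarith
  obtain ⟨hθ, hg⟩ := EPS.θ_g_eq_of_mismatch_eq_zero hconn hsec hs hmis
  refine Prod.ext (EPSState.ext_coords hθ (fun i => by rw [hω, hωe]) (fun i => ?_) hg) rfl
  have e1 := hz i
  have e2 := hze i
  rw [EPS.govDev] at e1 e2
  rw [hg] at e1
  linarith

theorem chp_asymptoticallyStable (hconn : eps.graph.Connected) (hA2 : eps.DampedSPR)
    (hpass : StrictlyPassive (dhs.field KT KI hL) (dhs.pH KT KI))
    (hHurwitz : Hurwitz (dhs.Acl KT KI)) {se : EPSState Bus r} {xs : DHSState m HP L N}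
    (hse : eps.field PL se (0 : HP → ℝ) = 0) (hsec : eps.Secure se)
    (hxs : dhs.field KT KI hL xs 0 = 0) (hfix : chpField eps dhs KT KI PL hL (se, xs) = 0) :
    AsymptoticallyStable (chpField eps dhs KT KI PL hL) (se, xs) := by
  obtain ⟨V, ρ, hρ, hVC, -, hV⟩ := hpass
  obtain ⟨c, hc, ε, hε, hquad⟩ := hA2.exists_weights
  obtain ⟨C, hC, hcross⟩ := eps.exists_crossEnergy_deriv_le (HP := HP) se
  obtain ⟨P, hPs, hPpos, a, ha, b, hb, hPA⟩ := hHurwitz.exists_iss_lyapunov dhs.Bclω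
  obtain ⟨hreg, K, hK⟩ := lipschitzC1_chpField eps dhs KT KI PL hL
  obtain ⟨hωe, hze, -⟩ := EPS.field_eq_zero_iff.1 hse
  -- The storage function is not assumed minimal at `xs`. It is locally so because the unforced flow
  -- converges to `xs` and, by passivity with zero input, never increases `V`.
  have hVmin : ∀ᶠ x in 𝓝 xs, V xs ≤ V x := by
    refine (hHurwitz.asymptoticallyStable xs).eventually_le hVC.continuous
      (decreasesAlong_of_fderiv_nonpos (hVC.differentiable one_ne_zero) fun x => ?_)
    have h1 := hV x 0
    rw [dhs.field_sub KT KI hL hxs, mulVec_zero, add_zero, dotProduct_zero, zero_sub] at h1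
    exact h1.trans (neg_nonpos.2 (mul_nonneg hρ.le (dotProduct_self_nonneg_real _)))
  -- Small enough that the input cost `δ b ‖ωHP‖²` of the quadratic term uses at most half of the
  -- electrical damping.
  set δ := ε / (2 * (b + 1)) with hδdef
  have hδ : 0 < δ := by positivity
  have hδb : δ * b ≤ ε / 2 := by
    rw [hδdef, div_mul_eq_mul_div, div_le_div_iff₀ (by positivity) two_pos]
    nlinarith
  -- Large enough that `M` times the decay of `W` pays for the `C`-terms of the cross energy, in `Y`
  -- and in `pH`, and leaves `Y` over.
  set M := 2 * (C + 1) / ε + C / ρ with hM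
  have hM0 : 0 < M := by positivity
  have hMε : C + 1 ≤ M * (ε / 2) := by
    have : M * (ε / 2) = C + 1 + C / ρ * (ε / 2) := by rw [hM]; field_simp
    rw [this]
    have : 0 ≤ C / ρ * (ε / 2) := by positivity
    linarith
  have hMρ : C ≤ M * ρ := by
    have : M * ρ = 2 * (C + 1) / ε * ρ + C := by rw [hM, add_mul, div_mul_cancel₀ _ hρ.ne']
    rw [this]
    have : 0 ≤ 2 * (C + 1) / ε * ρ := by positivity
    linarith
  let Y : EPSState Bus r → ℝ := fun s => ∑ i, (s.ω i ^ 2 + eps.govDev s i ^ 2)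
  have hY : ∀ s, 0 ≤ Y s := fun s => Finset.sum_nonneg fun i _ => by positivity
  let W : EPSState Bus r × DHSState m HP L N → ℝ := fun q =>
    eps.energy c se q.1 + V q.2 + δ * ((q.2 - xs) ⬝ᵥ P *ᵥ (q.2 - xs))
  let ψ : EPSState Bus r × DHSState m HP L N → ℝ := fun q =>
    1 / 4 * ∑ i, eps.mismatch se q.1 i ^ 2 + Y q.1 + M * δ * a * ((q.2 - xs) ⬝ᵥ (q.2 - xs))
  have hWc : Continuous W := by
    have h1 : Continuous fun q : EPSState Bus r × DHSState m HP L N => q.2 - xs :=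
      continuous_snd.sub continuous_const
    exact ((eps.continuous_energy c se continuous_fst).add
      (hVC.continuous.comp continuous_snd)).add
      (continuous_const.mul (h1.dotProduct (continuous_const.matrix_mulVec h1)))
  have hψc : Continuous ψ := by
    have h1 : Continuous fun q : EPSState Bus r × DHSState m HP L N => q.2 - xs :=
      continuous_snd.sub continuous_const
    have h2 := h1.dotProduct h1
    fun_prop
  have hsecure : ∀ᶠ q in 𝓝 (se, xs), eps.Secure q.1 :=
    continuous_fst.continuousAt.eventually (eps.isOpen_secure.mem_nhds hsec)
  have hVmin' : ∀ᶠ q in 𝓝 (se, xs), V xs ≤ V q.2 :=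
    (continuous_snd.tendsto (se, xs)).eventually hVmin
  have hWpos : ∀ᶠ q in 𝓝 (se, xs), q ≠ (se, xs) → W (se, xs) < W q := by
    filter_upwards [hsecure, hVmin'] with q hq hVq hne
    have hW0 : W (se, xs) = V xs := by
      have : eps.energy c se se = 0 := by
        simp [EPS.energy, EPS.lineEnergy, hωe, hze]
      simp [W, this]
    rw [hW0]
    have h1 := EPS.energy_nonneg hc hsec hq
    have h2 : 0 ≤ (q.2 - xs) ⬝ᵥ P *ᵥ (q.2 - xs) :=
      (dotProduct_self_nonneg_real _).trans (hPpos _)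
    by_cases hs : q.1 = se
    · have hx : q.2 ≠ xs := fun hx => hne (Prod.ext hs hx)
      have h3 := (dotProduct_self_pos_real (sub_ne_zero.2 hx)).trans_le (hPpos _)
      have := mul_pos hδ h3
      simp only [W]
      linarith
    · have h3 := EPS.energy_pos hconn hc hsec hq hωe hze hs
      have := mul_nonneg hδ.le h2
      simp only [W]
      linarith
  have hψpos : ∀ᶠ q in 𝓝 (se, xs), q ≠ (se, xs) → 0 < ψ q := by
    filter_upwards [hsecure] with q hq hne
    have h1 : 0 ≤ ∑ i, eps.mismatch se q.1 i ^ 2 := Finset.sum_nonneg fun i _ => sq_nonneg _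
    have h2 := hY q.1
    have h3 := dotProduct_self_nonneg_real (q.2 - xs)
    have h4 : 0 < M * δ * a := by positivity
    have h5 := mul_nonneg h4.le h3
    have h6 : 0 ≤ ψ q := by simp only [ψ]; linarith
    refine h6.lt_of_ne fun h0 => hne ?_
    simp only [ψ] at h0
    have e1 : ∑ i, eps.mismatch se q.1 i ^ 2 = 0 := by linarith
    have e2 : Y q.1 = 0 := by linarith
    have e3 : M * δ * a * ((q.2 - xs) ⬝ᵥ (q.2 - xs)) = 0 := by linarith
    have hx : q.2 = xs := sub_eq_zero.1
      (dotProduct_self_eq_zero.1 ((mul_eq_zero.1 e3).resolve_left h4.ne'))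
    have hmis : ∀ i, eps.mismatch se q.1 i = 0 := fun i =>
      pow_eq_zero_iff two_ne_zero |>.1
        ((Finset.sum_eq_zero_iff_of_nonneg fun i _ => sq_nonneg _).1 e1 i (Finset.mem_univ i))
    have hωz : ∀ i, q.1.ω i = 0 ∧ eps.govDev q.1 i = 0 := fun i => by
      have := (Finset.sum_eq_zero_iff_of_nonneg fun i _ => by positivity).1 e2 i
        (Finset.mem_univ i)
      constructor <;> nlinarith [sq_nonneg (q.1.ω i), sq_nonneg (eps.govDev q.1 i)]
    obtain ⟨hθ, hg⟩ := EPS.θ_g_eq_of_mismatch_eq_zero hconn hsec hq hmis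
    refine Prod.ext (EPSState.ext_coords hθ (fun i => ?_) (fun i => ?_) hg) hx
    · rw [(hωz i).1, hωe]; rfl
    · have e4 := (hωz i).2
      have e5 := hze i
      rw [EPS.govDev] at e4 e5
      rw [hg] at e4
      linarith
  -- The exchanged power `pH ⬝ᵥ ωHP` enters the energy and the storage estimate with opposite signs
  -- and disappears; the term `-ρ‖pH‖²` is kept, since the cross energy needs it.
  have hmain : ∀ q : ℝ → EPSState Bus r × DHSState m HP L N,
      IsSolution (chpField eps dhs KT KI PL hL) q → ∀ t : ℝ, 0 ≤ t →
      ∃ l : ℝ, HasDerivWithinAt (fun τ => W (q τ)) l (Set.Ici 0) t ∧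
        l ≤ -(ε / 2 * Y (q t).1 + ρ * (dhs.pH KT KI (q t).2 (eps.ωHP (q t).1) ⬝ᵥ
          dhs.pH KT KI (q t).2 (eps.ωHP (q t).1)) +
          δ * a * (((q t).2 - xs) ⬝ᵥ ((q t).2 - xs))) := by
    intro q hq t ht
    have hd := hq t ht
    have hd1 := hd.fst_of_prod
    have hd2 := hd.snd_of_prod
    simp only [chpField] at hd1 hd2
    set p := dhs.pH KT KI (q t).2 (eps.ωHP (q t).1) with hp
    set u := eps.ωHP (q t).1 with hu
    have k1 := EPS.hasDerivWithinAt_energy c hse hd1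
    have k2 := ((hVC.differentiable one_ne_zero) (q t).2).hasFDerivAt.comp_hasDerivWithinAt t hd2
    have k3 := (hd2.dotProduct_mulVec_self hPs xs).const_mul δ
    refine ⟨_, (k1.add k2).add k3, ?_⟩
    have j1 := hV (q t).2 u
    have j2 := hPA ((q t).2 - xs) u
    rw [← dhs.field_sub KT KI hL hxs] at j2
    have j3 := eps.ωHP_dotProduct_self_le (q t).1
    have j4 := Finset.sum_le_sum fun i (_ : i ∈ Finset.univ) =>
      hquad i ((q t).1.ω i) (eps.govDev (q t).1 i)
    rw [Finset.sum_neg_distrib, ← Finset.mul_sum] at j4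
    rw [← hp] at j1
    rw [← hu] at j3 ⊢
    have j5 : ∑ i, (q t).1.ω i ^ 2 ≤ Y (q t).1 :=
      Finset.sum_le_sum fun i _ => le_add_of_nonneg_right (sq_nonneg _)
    have j6 : δ * b * (u ⬝ᵥ u) ≤ ε / 2 * Y (q t).1 :=
      mul_le_mul hδb (j3.trans j5) (dotProduct_self_nonneg_real u) (by positivity)
    have j7 := mul_le_mul_of_nonneg_left j2 hδ.le
    change _ ≤ -(ε * Y (q t).1) at j4
    nlinarith
  have hp0 : ∀ p : HP → ℝ, 0 ≤ p ⬝ᵥ p := dotProduct_self_nonneg_real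
  refine asymptoticallyStable_of_lyapunov (L₀ := W) (ψ := ψ)
    (L₁ := fun q => M * W q + eps.crossEnergy se q.1) hK hreg hfix hWc
    ((continuous_const.mul hWc).add (eps.continuous_crossEnergy se continuous_fst)) hψc
    hWpos hψpos ?_ ?_
  · intro q hq t ht
    obtain ⟨l, hl, hle⟩ := hmain q hq t ht
    refine ⟨l, hle.trans (neg_le_neg ?_), hl⟩
    have := hY (q t).1
    have := hp0 (dhs.pH KT KI (q t).2 (eps.ωHP (q t).1))
    have := dotProduct_self_nonneg_real ((q t).2 - xs)
    simp only [Pi.zero_apply]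
    positivity
  · intro q hq t ht
    obtain ⟨l, hl, hle⟩ := hmain q hq t ht
    have hd1 := (hq t ht).fst_of_prod
    simp only [chpField] at hd1
    set p := dhs.pH KT KI (q t).2 (eps.ωHP (q t).1) with hp
    refine ⟨_, ?_, (hl.const_mul M).add (EPS.hasDerivWithinAt_crossEnergy hse hd1)⟩
    have j1 := hcross (q t).1 p
    have j2 := mul_le_mul_of_nonneg_left hle hM0.le
    have j3 := mul_le_mul_of_nonneg_right hMε (hY (q t).1)
    have j4 := mul_le_mul_of_nonneg_right hMρ (hp0 p)
    refine (add_le_add j2 j1).trans ?_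
    change _ + (_ + C * (Y (q t).1 + p ⬝ᵥ p)) ≤ _
    simp only [ψ]
    linarith

end Interconnection

theorem theorem1 {Bus HP L N : Type*} {r : Bus} {m : ℕ}
    [Fintype Bus] [Fintype HP] [Fintype L] [Fintype N]
    [DecidableEq Bus] [DecidableEq HP] [DecidableEq L] [DecidableEq N]
    (eps : EPS Bus HP r) (dhs : DHS m HP L N)
    (KT : Matrix (Fin (m + 1)) (TempIdx m HP L N) ℝ)
    (KI : Matrix (Fin (m + 1)) (ErrIdx m) ℝ)
    (PL : Bus → ℝ) (hL : L → ℝ)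
    (hconn : eps.graph.Connected)
    (hA1 : eps.AdmitsEquilibrium PL 0)
    (hA2 : eps.DampedSPR)
    (hpass : StrictlyPassive (dhs.field KT KI hL) (dhs.pH KT KI))
    (hHurwitz : Hurwitz (dhs.Acl KT KI)) :
    ∃ s : EPSState Bus r × DHSState m HP L N,
      (chpField eps dhs KT KI PL hL s = 0 ∧ eps.Secure s.1) ∧
      (∀ s' : EPSState Bus r × DHSState m HP L N,
        chpField eps dhs KT KI PL hL s' = 0 → eps.Secure s'.1 → s' = s) ∧
      s.1.ω = 0 ∧
      dhs.err KT KI s.2 = 0 ∧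
      AsymptoticallyStable (chpField eps dhs KT KI PL hL) s := by
  obtain ⟨se, hse, -, hsec⟩ := hA1
  have hA := hHurwitz.isUnit
  obtain ⟨xs, hxs⟩ := dhs.exists_field_eq_zero KT KI hL hA
  have hω := (EPS.field_eq_zero_iff.1 hse).1
  have hout : dhs.pH KT KI xs 0 = 0 := by
    obtain ⟨V, ρ, hρ, -, -, hV⟩ := hpass
    exact output_eq_zero_of_passive hρ hV hxs
  have hfix : chpField eps dhs KT KI PL hL (se, xs) = 0 := by
    refine Prod.ext ?_ ?_
    · simpa [chpField, eps.ωHP_eq_zero hω, hout] using hse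
    · simpa [chpField, eps.ωHP_eq_zero hω] using hxs
  refine ⟨(se, xs), ⟨hfix, hsec⟩, fun s' h hs' => ?_, hω, ?_,
    chp_asymptoticallyStable hconn hA2 hpass hHurwitz hse hsec hxs hfix⟩
  · exact chpField_eq_zero_unique hconn hA hse hsec hxs hout h hs'
  · funext j
    -- At rest the integrator equations say that the error is zero.
    rw [← dhs.field_inr KT KI hL xs 0 j, hxs]
    rfl
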